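/- **Setting.** Let $f:\mathbb R^{d_x}\times\mathbb R^{d_u}\to\mathbb R^{d_x}$ be Borel measurable, let $1\le \tau_{\rm obs}\le\tau_{\rm chunk}$ and $H$ be integers, $T=H\tau_{\rm chunk}$, $t_h=(h-1)\tau_{\rm chunk}+1$. A trajectory of length $n$ is $\rho=(x_{1:n+1},u_{1:n})$ with $x_t\in\mathbb R^{d_x}$, $u_t\in\mathbb R^{d_u}$; put $d_{\rm traj}(\rho,\rho')=\max\{\max_t\|x_t-x_t'\|,\max_t\|u_t-u'_t\|\}$. The expert law $D_{\exp}$ is a probability measure on trajectories of length $T$ that almost surely satisfy $x_{t+1}=f(x_t,u_t)$. The observation chunk at $h$ is $o_h=(x_{t_h-\tau_{\rm obs}+1:t_h},u_{t_h-\tau_{\rm obs}+1:t_h-1})$, with zeros at times $<1$. A primitive controller is $\kappa=(\bar u,\bar x,\bar K)$, acting by $\kappa(x)=\bar u+\bar K(x-\bar x)$; a composite action is $\mathsf a=(\kappa_1,\dots,\kappa_{\tau_{\rm chunk}})$, and $d_{\max}(\mathsf a,\mathsf a')=\max_k(\|\bar u_k-\bar u_k'\|+\|\bar x_k-\bar x'_k\|+\|\bar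 K_k-\bar K'_k\|)$ (Euclidean and operator norms). A synthesis oracle is a measurable map $\mathtt{synth}$ from trajectories of length $T$ to sequences $\kappa_{1:T}$; put $\mathsf a_h=\kappa_{t_h:t_{h+1}-1}$. Let $D_{\exp,h}$ be the law of $(\mathsf a_h,o_h)$ for $\rho\sim D_{\exp}$, $\kappa_{1:T}=\mathtt{synth}(\rho)$, and let $\pi^\star_h$ be any regular conditional distribution of $\mathsf a_h$ given $o_h$ under $D_{\exp,h}$. A chunking policy $\pi=(\pi_h)_{h\le H}$ consists of probability kernels from observation chunks to composite actions. It induces a trajectory law $D_\pi$: draw $x_1$ from its law under $D_{\exp}$; for each $h$ draw $\mathsf a_h\sim\pi_h(o_h)$, and set $u_t=\kappa_t(x_t)$, $x_{t+1}=f(x_t,u_t)$ for $t_h\le t<t_{h+1}$. The policy is $\gamma$-TVC, for $\gamma:\mathbb R_{\ge0}\to\mathbb R_{\ge0}$, if $\mathsf{TV}(\pi_h(o),\pi_h(o'))\le\gamma(d_{\rm traj}(o,o'))$ for all $h,o,o'$, where $\mathsf{TV}(P,Q)=\sup_A|P(A)-Q(A)|$. Define $$\Gamma_{\mathrm{marg},\epsilon}(\pi)=\max_{1\le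 t\le T}\ \inf_{\mu}\ \Pr_\mu\big[\max\{\|x^{\exp}_{t+1}-x^\pi_{t+1}\|,\|u^{\exp}_t-u^\pi_t\|\}>\epsilon\big],$$ with $\mu$ ranging over all couplings of $D_{\exp}$ and $D_\pi$. For laws $P,Q$ of composite actions let $\Delta_r(P,Q)=\inf_\mu\Pr_\mu[d_{\max}(\mathsf a,\mathsf a')>r]$ and $W_{1,d_{\max}}(P,Q)=\inf_\mu\mathbb E_\mu[d_{\max}(\mathsf a,\mathsf a')]\in[0,\infty]$, the infima being over couplings of $P$ and $Q$. **Local t-ISS.** Given $\mathsf a=(\kappa_1,\dots,\kappa_\tau)$, $\xi\in\mathbb R^{d_x}$ and $\delta u_{1:\tau}\in(\mathbb R^{d_u})^\tau$, let $x^{\mathsf a}_1=\xi$ and $x^{\mathsf a}_{i+1}=f(x^{\mathsf a}_i,\kappa_i(x^{\mathsf a}_i)+\delta u_i)$. Then $\mathsf a$ is local t-ISS at $\xi_0$ with moduli $\gamma,\beta$ and parameters $c_u,c_\xi$ if for all $\xi,\xi',\delta u_{1:\tau}$ with $\|\xi-\xi_0\|,\|\xi'-\xi_0\|\le c_\xi$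 and $\max_s\|\delta u_s\|\le c_u$, and all $1\le i\le\tau+1$, $$\|x^{\mathsf a}_i(0,\xi)-x^{\mathsf a}_i(\delta u_{1:\tau},\xi')\|\le\beta(\|\xi-\xi'\|,i)+\gamma\Big(\max_{1\le s\le i-1}\|\delta u_s\|\Big),$$ the maximum of the empty set being $0$. **Assumption.** There are $c_u,c_\xi,\bar c_\gamma,\bar c_\beta>0$, $L_\beta\in(0,1]$, $R_{\rm dyn}$ and $R_K$ such that, almost surely for $\rho=(x_{1:T+1},u_{1:T})\sim D_{\exp}$ and $\kappa_{1:T}=\mathtt{synth}(\rho)$: $\bar x_t=x_t$ and $\bar u_t=u_t$ for all $t\le T$; for every $h$, $\mathsf a_h$ is local t-ISS at $x_{t_h}$ with parameters $c_u,c_\xi$ and moduli $\gamma(r)=\bar c_\gamma r$, $\beta(r,k)=\bar c_\beta e^{-(k-1)L_\beta}r$; and $\|x_t\|,\|u_t\|\le R_{\rm dyn}$, $\|\bar K_t\|\le R_K$ for all $t$. **Constants.** Let $\epsilon_0=\min\{c_u,c_\xi/(4\bar c_\gamma)\}$, $\alpha=\bar c_\beta(4\bar c_\gamma\epsilon_0+c_\xi)$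 and $$c_1=\big(1+4\bar c_\gamma\bar c_\beta(1+R_K)\big)\big(2+\alpha+R_K+2R_{\rm dyn}\big),\quad c_2=\min\Big\{1,\frac{\epsilon_0}{\max\{1,c_1\}}\Big\},\quad c_3=\frac{\log(2e\bar c_\beta)}{L_\beta}.$$ **Theorem.** Suppose the Assumption holds, $0\le\epsilon<c_2$ and $\tau_{\rm chunk}\ge c_3$. Then for every non-decreasing $\gamma_{\rm TVC}:\mathbb R_{\ge0}\to\mathbb R_{\ge0}$ and every $\gamma_{\rm TVC}$-TVC chunking policy $\hat\pi$, $$\Gamma_{\mathrm{marg},\epsilon}(\hat\pi)\le H\gamma_{\rm TVC}(\epsilon)+\sum_{h=1}^H\mathbb E_{o_h\sim D_{\exp,h}}\big[\Delta_{\epsilon/c_1}(\pi^\star_h(o_h),\hat\pi_h(o_h))\big],$$ and, if $\epsilon>0$, $$\sum_{h=1}^H\mathbb E_{o_h\sim D_{\exp,h}}\big[\Delta_{\epsilon/c_1}(\pi^\star_h(o_h),\hat\pi_h(o_h))\big]\le\frac{c_1}{\epsilon}\sum_{h=1}^H\mathbb E_{o_h\sim D_{\exp,h}}\big[W_{1,d_{\max}}(\pi^\star_h(o_h),\hat\pi_h(o_h))\big].$$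 -/

import Mathlib

open MeasureTheory ProbabilityTheory Finset
open scoped NNReal ENNReal

noncomputable section

/-- The Euclidean space of dimension `d`. -/
abbrev Vec (d : ℕ) : Type := EuclideanSpace ℝ (Fin d)

/-- A primitive (affine) controller, as a triple `(uBar, xBar, KBar)`. -/
abbrev PrimCtrl (dx du : ℕ) : Type := Vec du × Vec dx × (Vec dx →L[ℝ] Vec du)

/-- The input that the controller plays at the state `x`, namely `uBar + KBar (x - xBar)`. -/
def applyCtrl {dx du : ℕ} (κ : PrimCtrl dx du) (x : Vec dx) : Vec du :=
  κ.1 + κ.2.2 (x - κ.2.1)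

/-- A composite action (chunk): `τ` primitive controllers, played one after the other. -/
abbrev CompAct (dx du τ : ℕ) : Type := Fin τ → PrimCtrl dx du

/-- Trajectories with `n + 1` states and `n` inputs. Times are counted from `0`. -/
abbrev Traj (dx du n : ℕ) : Type := (Fin (n + 1) → Vec dx) × (Fin n → Vec du)

/-- The state at time `t` (`0` beyond the end of the trajectory). -/
def stateAt {dx du n : ℕ} (ρ : Traj dx du n) (t : ℕ) : Vec dx :=
  if h : t < n + 1 then ρ.1 ⟨t, h⟩ else 0

/-- The input at time `t` (`0` beyond the end of the trajectory). -/
def inputAt {dx du n : ℕ} (ρ : Traj dx du n) (t : ℕ) : Vec du :=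
  if h : t < n then ρ.2 ⟨t, h⟩ else 0

theorem measurable_stateAt {dx du n : ℕ} (t : ℕ) :
    Measurable (fun ρ : Traj dx du n => stateAt ρ t) := by
  unfold stateAt
  split_ifs with h
  · exact (measurable_pi_apply _).comp measurable_fst
  · exact measurable_const

theorem measurable_inputAt {dx du n : ℕ} (t : ℕ) :
    Measurable (fun ρ : Traj dx du n => inputAt ρ t) := by
  unfold inputAt
  split_ifs with h
  · exact (measurable_pi_apply _).comp measurable_snd
  · exact measurable_const

/-- The observation chunk at the start of chunk `h`: the last `τobs` states up to and including
time `h * τ`, and the `τobs - 1` inputs between them. Entries at negative times are `0`. -/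
def obsChunk {dx du n : ℕ} (τ τobs h : ℕ) (ρ : Traj dx du n) : Traj dx du (τobs - 1) :=
  (fun j => if τobs ≤ h * τ + j + 1 then stateAt ρ (h * τ + j + 1 - τobs) else 0,
   fun j => if τobs ≤ h * τ + j + 1 then inputAt ρ (h * τ + j + 1 - τobs) else 0)

theorem measurable_obsChunk {dx du n : ℕ} (τ τobs h : ℕ) :
    Measurable (fun ρ : Traj dx du n => obsChunk τ τobs h ρ) := by
  unfold obsChunk
  refine Measurable.prodMk (measurable_pi_lambda _ fun j => ?_) (measurable_pi_lambda _ fun j => ?_)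
  · split_ifs
    · exact measurable_stateAt _
    · exact measurable_const
  · split_ifs
    · exact measurable_inputAt _
    · exact measurable_const

/-- The time of step `k` of chunk `h`. -/
def chunkIdx {H τ : ℕ} (h : Fin H) (k : Fin τ) : Fin (H * τ) :=
  ⟨h * τ + k, by
    calc (h : ℕ) * τ + k < h * τ + τ := Nat.add_lt_add_left k.2 _
      _ = (h + 1) * τ := by ring
      _ ≤ H * τ := Nat.mul_le_mul_right _ h.2⟩

/-- Chunk `h` of a sequence of `H * τ` primitive controllers. -/
def chunkAct {dx du H τ : ℕ} (h : Fin H) (κ : Fin (H * τ) → PrimCtrl dx du) : CompAct dx du τ :=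
  fun k => κ (chunkIdx h k)

/-- The states that arise from the state `ξ` at step `0` when the composite action `a` is played,
with the additive input perturbation `δu`, through the dynamics `f` (constant after step `τ`). -/
def rollout {dx du τ : ℕ} (f : Vec dx → Vec du → Vec dx) (a : CompAct dx du τ)
    (δu : Fin τ → Vec du) (ξ : Vec dx) : ℕ → Vec dx
  | 0 => ξ
  | k + 1 =>
      if hk : k < τ then
        f (rollout f a δu ξ k) (applyCtrl (a ⟨k, hk⟩) (rollout f a δu ξ k) + δu ⟨k, hk⟩)
      else rollout f a δu ξ k

/-- Local time-varying incremental input-to-state stability of `a` at `ξ0`, with gain `γ`, decay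
`β` and radii `cu` (inputs), `cξ` (initial states). With steps counted from `1`, step `i = k + 1`
compares the unperturbed rollout from `ξ` with the perturbed one from `ξ'`; the maximum of the
perturbations played before that step is `0` when there are none. -/
def IsLocalTISS {dx du τ : ℕ} (f : Vec dx → Vec du → Vec dx)
    (γ : ℝ → ℝ) (β : ℝ → ℕ → ℝ) (cu cξ : ℝ) (a : CompAct dx du τ) (ξ0 : Vec dx) : Prop :=
  ∀ (ξ ξ' : Vec dx) (δu : Fin τ → Vec du),
    ‖ξ - ξ0‖ ≤ cξ → ‖ξ' - ξ0‖ ≤ cξ → (∀ s, ‖δu s‖ ≤ cu) →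
    ∀ k : ℕ, k ≤ τ →
      ‖rollout f a 0 ξ k - rollout f a δu ξ' k‖ ≤
        β ‖ξ - ξ'‖ (k + 1) +
          γ (((univ.filter fun s : Fin τ => (s : ℕ) < k).sup fun s => ‖δu s‖₊ : ℝ≥0) : ℝ)

/-- The scalars of the stability assumption: the radii `cu`, `cξ`, the coefficients `cγ`, `cβ` of
the gain and of the decay, the decay rate `L`, the bound `Rdyn` on states and inputs, and the
bound `RK` on feedback gains. -/
structure StabParams where
  cu : ℝ
  cξ : ℝ
  cγ : ℝ
  cβ : ℝ
  L : ℝ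
  Rdyn : ℝ
  RK : ℝ

namespace StabParams

/-- The gain `γ(r) = cγ r`. -/
def gain (p : StabParams) : ℝ → ℝ := fun r => p.cγ * r

/-- The decay `β(r, i) = cβ exp(-L (i - 1)) r`. -/
def decay (p : StabParams) : ℝ → ℕ → ℝ := fun r i =>
  p.cβ * Real.exp (-(p.L * ((i : ℝ) - 1))) * r

/-- The radius `min {cu, cξ / (4 cγ)}`. -/
def radius (p : StabParams) : ℝ := min p.cu (p.cξ / (4 * p.cγ))

/-- `α = cβ (4 cγ radius + cξ)`. -/
def spread (p : StabParams) : ℝ := p.cβ * (4 * p.cγ * p.radius + p.cξ)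

def c1 (p : StabParams) : ℝ :=
  (1 + 4 * p.cγ * p.cβ * (1 + p.RK)) * (2 + p.spread + p.RK + 2 * p.Rdyn)

def c2 (p : StabParams) : ℝ := min 1 (p.radius / max 1 p.c1)

def c3 (p : StabParams) : ℝ := Real.log (2 * Real.exp 1 * p.cβ) / p.L

end StabParams

/-- The stability assumption on the expert law `D` and the synthesis oracle `synth`: almost surely
the synthesized controllers are consistent with the trajectory, every composite action is locally
stable at the state where its chunk starts, and everything is bounded. -/
structure StabilityAssumption {dx du H τ : ℕ} (f : Vec dx → Vec du → Vec dx)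
    (D : Measure (Traj dx du (H * τ)))
    (synth : Traj dx du (H * τ) → Fin (H * τ) → PrimCtrl dx du) (p : StabParams) : Prop where
  cu_pos : 0 < p.cu
  cξ_pos : 0 < p.cξ
  cγ_pos : 0 < p.cγ
  cβ_pos : 0 < p.cβ
  L_pos : 0 < p.L
  L_le_one : p.L ≤ 1
  consistent : ∀ᵐ ρ ∂D, ∀ t : Fin (H * τ),
    (synth ρ t).1 = ρ.2 t ∧ (synth ρ t).2.1 = ρ.1 t.castSucc
  stable : ∀ᵐ ρ ∂D, ∀ h : Fin H,
    IsLocalTISS f p.gain p.decay p.cu p.cξ (chunkAct h (synth ρ)) (stateAt ρ (h * τ))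
  states_bounded : ∀ᵐ ρ ∂D, ∀ t, ‖ρ.1 t‖ ≤ p.Rdyn
  inputs_bounded : ∀ᵐ ρ ∂D, ∀ t, ‖ρ.2 t‖ ≤ p.Rdyn
  gains_bounded : ∀ᵐ ρ ∂D, ∀ t, ‖(synth ρ t).2.2‖ ≤ p.RK

/-- The distance between composite actions: the largest, over the steps, sum of the distances of
the three components (Euclidean, Euclidean, operator norm). -/
def dMax {dx du τ : ℕ} (a b : CompAct dx du τ) : ℝ≥0 :=
  univ.sup fun k => nndist (a k).1 (b k).1 + nndist (a k).2.1 (b k).2.1 +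
    nndist (a k).2.2 (b k).2.2

/-- The distance between trajectories: the largest distance of states or of inputs. -/
def dTraj {dx du n : ℕ} (ρ ρ' : Traj dx du n) : ℝ≥0 :=
  max (univ.sup fun t => nndist (ρ.1 t) (ρ'.1 t)) (univ.sup fun t => nndist (ρ.2 t) (ρ'.2 t))

/-- `μ` is a coupling of `P` and `Q`. -/
def IsCoupling {A B : Type*} [MeasurableSpace A] [MeasurableSpace B]
    (μ : Measure (A × B)) (P : Measure A) (Q : Measure B) : Prop :=
  μ.map Prod.fst = P ∧ μ.map Prod.snd = Q

/-- `Δ_r(P, Q)`, the infimum over couplings of the probability that `dMax` exceeds `r`. -/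
def otProb {dx du τ : ℕ} (r : ℝ) (P Q : Measure (CompAct dx du τ)) : ℝ≥0∞ :=
  ⨅ (μ : Measure (CompAct dx du τ × CompAct dx du τ)) (_ : IsCoupling μ P Q),
    μ {z | r < (dMax z.1 z.2 : ℝ)}

/-- The `1`-Wasserstein distance for `dMax`. -/
def wass1 {dx du τ : ℕ} (P Q : Measure (CompAct dx du τ)) : ℝ≥0∞ :=
  ⨅ (μ : Measure (CompAct dx du τ × CompAct dx du τ)) (_ : IsCoupling μ P Q),
    ∫⁻ z, (dMax z.1 z.2 : ℝ≥0∞) ∂μ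

/-- The total variation distance, the supremum over measurable `S` of `|P S - Q S|`. It is
meant for probability measures. -/
def tvDist {A : Type*} [MeasurableSpace A] (P Q : Measure A) : ℝ :=
  ⨆ S : {S : Set A // MeasurableSet S}, |P.real S.1 - Q.real S.1|

/-- A chunking policy: for each chunk a kernel from observation chunks to composite actions. -/
abbrev ChunkPolicy (dx du H τ τobs : ℕ) : Type :=
  Fin H → Kernel (Traj dx du (τobs - 1)) (CompAct dx du τ)

/-- `γ`-total-variation continuity of a chunking policy. -/
def IsTVC {dx du H τ τobs : ℕ} (γ : ℝ≥0 → ℝ≥0) (π : ChunkPolicy dx du H τ τobs) : Prop :=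
  ∀ (h : Fin H) (o o' : Traj dx du (τobs - 1)), tvDist (π h o) (π h o') ≤ γ (dTraj o o')

/-- The trajectory with initial state `x` and zeros elsewhere. -/
def initTraj {dx du : ℕ} (n : ℕ) (x : Vec dx) : Traj dx du n :=
  (fun t => if (t : ℕ) = 0 then x else 0, 0)

/-- Play the composite action `a` during chunk `h`, that is at the times `h * τ + k` with `k < τ`,
from the current state at time `h * τ`; the rest of the trajectory is left as it is. -/
def execChunk {dx du n τ : ℕ} (f : Vec dx → Vec du → Vec dx) (h : ℕ) (ρ : Traj dx du n)
    (a : CompAct dx du τ) : Traj dx du n :=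
  (fun t =>
    if h * τ < (t : ℕ) ∧ (t : ℕ) ≤ h * τ + τ then
      rollout f a 0 (stateAt ρ (h * τ)) ((t : ℕ) - h * τ)
    else ρ.1 t,
   fun t =>
    if hk : h * τ ≤ (t : ℕ) ∧ (t : ℕ) - h * τ < τ then
      applyCtrl (a ⟨(t : ℕ) - h * τ, hk.2⟩)
        (rollout f a 0 (stateAt ρ (h * τ)) ((t : ℕ) - h * τ))
    else ρ.2 t)

/-- The law of the trajectory after the first `m` chunks have been played by the policy `π` from
an initial state with law `ν`. In chunk `m` the action is drawn from `π` at the current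
observation chunk and is then played through the dynamics. -/
def partialLaw {dx du H τ τobs : ℕ} (f : Vec dx → Vec du → Vec dx) (ν : Measure (Vec dx))
    (π : ChunkPolicy dx du H τ τobs) : ℕ → Measure (Traj dx du (H * τ))
  | 0 => ν.map (initTraj (H * τ))
  | m + 1 =>
      if hm : m < H then
        (partialLaw f ν π m ⊗ₘ
            (π ⟨m, hm⟩).comap (fun ρ : Traj dx du (H * τ) => obsChunk τ τobs m ρ)
              (measurable_obsChunk τ τobs m)).map
          (fun z => execChunk f m z.1 z.2)
      else partialLaw f ν π m

/-- The law of the trajectory of the policy `π`, started from the initial-state law of `D`. -/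
def policyLaw {dx du H τ τobs : ℕ} (f : Vec dx → Vec du → Vec dx)
    (D : Measure (Traj dx du (H * τ))) (π : ChunkPolicy dx du H τ τobs) :
    Measure (Traj dx du (H * τ)) :=
  partialLaw f (D.map fun ρ => ρ.1 0) π H

/-- The marginal imitation loss between two trajectory laws: the largest, over times, infimum over
couplings of the probability that the next states or the current inputs differ by more
than `ε`. -/
def margLoss {dx du n : ℕ} (ε : ℝ) (D D' : Measure (Traj dx du n)) : ℝ≥0∞ :=
  ⨆ t : Fin n, ⨅ (μ : Measure (Traj dx du n × Traj dx du n)) (_ : IsCoupling μ D D'),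
    μ {z | ε < max ‖z.1.1 t.succ - z.2.1 t.succ‖ ‖z.1.2 t - z.2.2 t‖}

/-- The joint law of the observation chunk and the composite action of the expert at chunk `h`. -/
def expertChunkLaw {dx du H τ : ℕ} (τobs : ℕ) (D : Measure (Traj dx du (H * τ)))
    (synth : Traj dx du (H * τ) → Fin (H * τ) → PrimCtrl dx du) (h : Fin H) :
    Measure (Traj dx du (τobs - 1) × CompAct dx du τ) :=
  D.map fun ρ => (obsChunk τ τobs h ρ, chunkAct h (synth ρ))

end

/-!
The expert is coupled with the imitator one chunk at a time. Given a coupling of the expert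
trajectory with that of the imitator after the previous chunks, only the expert's observation `o_h`
is kept. Conditionally on it, the expert action `a_h` is coupled nearly optimally with an action of
the policy at `o_h`, and total variation continuity pays `γ ε` for moving the policy to the
imitator's own observation. The result is glued back to the whole expert trajectory along
`(o_h, a_h)`, which forgets how the expert's past was coupled with the imitator's: this is why only
the marginal loss is controlled.

Stability stops the errors from accumulating. Replaying the imitator's controllers from the expert's
is an input perturbation of size at most some `U`, so during a chunk the states stay within
`cβ (2 cγ U) + cγ U`. Since `cβ exp (-L τ) ≤ 1 / 2` for `τ ≥ c3`, a state gap of at most `2 cγ U` at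
the start of a chunk is again at most `2 cγ U` at its end: this is the gap that chunks hand over.
-/

/-! ### Stability of a single chunk -/

section ChunkStability

variable {dx du τ : ℕ} {f : Vec dx → Vec du → Vec dx} {a b : CompAct dx du τ} {ξ ξ' : Vec dx}

theorem norm_applyCtrl_sub_le {κ κ' : PrimCtrl dx du} {y : Vec dx} {r α R : ℝ}
    (h : (nndist κ.1 κ'.1 + nndist κ.2.1 κ'.2.1 + nndist κ.2.2 κ'.2.2 : ℝ) ≤ r) (hr : r ≤ 1)
    (hR : ‖κ.2.2‖ ≤ R) (hy : ‖y - κ.2.1‖ ≤ α) :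
    ‖applyCtrl κ' y - applyCtrl κ y‖ ≤ r * (1 + α + R) := by
  obtain ⟨u, x, K⟩ := κ
  obtain ⟨u', x', K'⟩ := κ'
  simp only [coe_nndist, dist_eq_norm'] at h hR hy
  have hu := norm_nonneg (u' - u)
  have hx := norm_nonneg (x' - x)
  have hK := norm_nonneg (K' - K)
  have hα : 0 ≤ α := (norm_nonneg _).trans hy
  have hR0 : 0 ≤ R := (norm_nonneg _).trans hR
  have hdecomp : applyCtrl (u', x', K') y - applyCtrl (u, x, K) y =
      (u' - u) + (K' - K) (y - x) - K' (x' - x) := by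
    simp only [applyCtrl, map_sub, sub_apply]
    abel
  have hgain : ‖(K' - K) (y - x)‖ ≤ ‖K' - K‖ * α := (K' - K).le_opNorm_of_le hy
  have hcenter : ‖K' (x' - x)‖ ≤ (R + 1) * ‖x' - x‖ := by
    refine K'.le_of_opNorm_le ?_ _
    calc ‖K'‖ = ‖K + (K' - K)‖ := by rw [add_sub_cancel]
      _ ≤ ‖K‖ + ‖K' - K‖ := norm_add_le _ _
      _ ≤ R + 1 := by linarith
  calc ‖applyCtrl (u', x', K') y - applyCtrl (u, x, K) y‖
      ≤ ‖u' - u‖ + ‖(K' - K) (y - x)‖ + ‖K' (x' - x)‖ := by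
        rw [hdecomp]
        exact (norm_sub_le _ _).trans (add_le_add_left (norm_add_le _ _) _)
    _ ≤ ‖u' - u‖ + ‖K' - K‖ * α + (R + 1) * ‖x' - x‖ := by gcongr
    _ ≤ (‖u' - u‖ + ‖x' - x‖ + ‖K' - K‖) * (1 + α + R) := by
        linarith [mul_nonneg hu (add_nonneg hα hR0), mul_nonneg hx hα,
          mul_nonneg hK (add_nonneg zero_le_one hR0)]
    _ ≤ r * (1 + α + R) := by gcongr

theorem rollout_congr {δ δ' : Fin τ → Vec du} {k : ℕ}
    (h : ∀ s : Fin τ, (s : ℕ) < k → δ s = δ' s) :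
    rollout f a δ ξ k = rollout f a δ' ξ k := by
  induction k with
  | zero => rfl
  | succ k ih =>
    have ih' := ih fun s hs => h s (by omega)
    by_cases hk : k < τ
    · simp only [rollout, hk, dite_true, ih', h ⟨k, hk⟩ (Nat.lt_succ_self k)]
    · simp only [rollout, hk, dite_false, ih']

/-- The input perturbation with which the composite action `a` reproduces the rollout of `b`
from `ξ`. -/
noncomputable def inputGap (f : Vec dx → Vec du → Vec dx) (a b : CompAct dx du τ) (ξ : Vec dx)
    (s : Fin τ) : Vec du :=
  applyCtrl (b s) (rollout f b 0 ξ s) - applyCtrl (a s) (rollout f b 0 ξ s)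

theorem rollout_inputGap (k : ℕ) : rollout f a (inputGap f a b ξ) ξ k = rollout f b 0 ξ k := by
  induction k with
  | zero => rfl
  | succ k ih =>
    by_cases hk : k < τ
    · simp only [rollout, hk, dite_true, ih, inputGap, add_sub_cancel, Pi.zero_apply, add_zero]
    · simp only [rollout, hk, dite_false, ih]

theorem norm_applyCtrl_rollout_sub_le {R R' U : ℝ} {k : Fin τ} (hK : ‖(a k).2.2‖ ≤ R)
    (hgap : ‖inputGap f a b ξ' k‖ ≤ U)
    (hk : ‖rollout f a 0 ξ k - rollout f b 0 ξ' k‖ ≤ R') :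
    ‖applyCtrl (a k) (rollout f a 0 ξ k) - applyCtrl (b k) (rollout f b 0 ξ' k)‖ ≤
      R * R' + U := by
  have hdecomp : applyCtrl (a k) (rollout f a 0 ξ k) - applyCtrl (b k) (rollout f b 0 ξ' k) =
      (a k).2.2 (rollout f a 0 ξ k - rollout f b 0 ξ' k) - inputGap f a b ξ' k := by
    simp only [inputGap, applyCtrl, map_sub]
    abel
  rw [hdecomp]
  exact (norm_sub_le _ _).trans
    (add_le_add ((a k).2.2.le_of_opNorm_le_of_le hK hk) hgap)

section IncrementalStability

variable {γ : ℝ → ℝ} {β : ℝ → ℕ → ℝ} {cu cξ U : ℝ}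

theorem IsLocalTISS.norm_rollout_sub_le (ha : IsLocalTISS f γ β cu cξ a ξ) (hγ : Monotone γ)
    (hξ : ‖ξ - ξ'‖ ≤ cξ) (hU : 0 ≤ U) (hUcu : U ≤ cu) {k : ℕ} (hk : k ≤ τ)
    (hgap : ∀ s : Fin τ, (s : ℕ) < k → ‖inputGap f a b ξ' s‖ ≤ U) :
    ‖rollout f a 0 ξ k - rollout f b 0 ξ' k‖ ≤ β ‖ξ - ξ'‖ (k + 1) + γ U := by
  let δ : Fin τ → Vec du := fun s => if (s : ℕ) < k then inputGap f a b ξ' s else 0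
  have hδ (s : Fin τ) : ‖δ s‖ ≤ U := by
    by_cases hs : (s : ℕ) < k
    · simpa only [δ, if_pos hs] using hgap s hs
    · simpa only [δ, if_neg hs, norm_zero] using hU
  have hroll : rollout f a δ ξ' k = rollout f b 0 ξ' k := by
    rw [rollout_congr (δ' := inputGap f a b ξ') fun s hs => if_pos hs, rollout_inputGap]
  have hiss := ha ξ ξ' δ (by simpa using (norm_nonneg _).trans hξ) (by rwa [norm_sub_rev])
    (fun s => (hδ s).trans hUcu) k hk
  rw [hroll] at hiss
  refine hiss.trans (add_le_add_right (hγ ?_) _)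
  lift U to ℝ≥0 using hU
  exact NNReal.coe_le_coe.2 (Finset.sup_le fun s _ => hδ s)

/-- As long as the states stay within `R`, the perturbations stay below `U`, which in turn keeps
the next states within `R`. -/
theorem IsLocalTISS.norm_rollout_sub_le_of_bootstrap (ha : IsLocalTISS f γ β cu cξ a ξ)
    (hγ : Monotone γ) (hξ : ‖ξ - ξ'‖ ≤ cξ) (hU : 0 ≤ U) (hUcu : U ≤ cu) {R : ℝ}
    (hR : ∀ k ≤ τ, β ‖ξ - ξ'‖ (k + 1) + γ U ≤ R)
    (hgap : ∀ s : Fin τ, ‖rollout f a 0 ξ s - rollout f b 0 ξ' s‖ ≤ R →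
      ‖inputGap f a b ξ' s‖ ≤ U) {k : ℕ} (hk : k ≤ τ) :
    ‖rollout f a 0 ξ k - rollout f b 0 ξ' k‖ ≤ β ‖ξ - ξ'‖ (k + 1) + γ U := by
  induction k using Nat.strong_induction_on with
  | _ k ih =>
    exact ha.norm_rollout_sub_le hγ hξ hU hUcu hk fun s hs =>
      hgap s ((ih s hs s.2.le).trans (hR s s.2.le))

end IncrementalStability

namespace StabParams

/-- Positivity of the radii, of the stability coefficients and of the decay rate, and
nonnegativity of the bound on the gains. -/
structure Positive (p : StabParams) : Prop where
  cu : 0 < p.cu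
  cξ : 0 < p.cξ
  cγ : 0 < p.cγ
  cβ : 0 < p.cβ
  L : 0 < p.L
  RK : 0 ≤ p.RK

/-- The factor by which a chunk amplifies an input perturbation. -/
def amplification (p : StabParams) : ℝ := 1 + 4 * p.cγ * p.cβ * (1 + p.RK)

/-- The amplification of a deviation between composite actions; `c1` is a larger constant. -/
noncomputable def c0 (p : StabParams) : ℝ := p.amplification * (1 + p.spread + p.RK)

/-- The input perturbation that a chunk tolerates if states and inputs are to stay `ε`-close. -/
noncomputable def inputTol (p : StabParams) (ε : ℝ) : ℝ := ε / p.amplification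

/-- The deviation of states that may be carried over from one chunk to the next. -/
noncomputable def stateTol (p : StabParams) (ε : ℝ) : ℝ := 2 * p.cγ * p.inputTol ε

/-- The deviation of composite actions that a chunk tolerates. -/
noncomputable def actTol (p : StabParams) (ε : ℝ) : ℝ := ε / p.c0

variable {p : StabParams} {ε : ℝ}

namespace Positive

variable (hp : p.Positive)
include hp

theorem radius_pos : 0 < p.radius :=
  lt_min hp.cu (div_pos hp.cξ (mul_pos four_pos hp.cγ))

theorem spread_pos : 0 < p.spread := by
  have := hp.cγ
  have := hp.cβ
  have := hp.cξ
  have := hp.radius_pos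
  unfold spread
  positivity

theorem one_le_amplification : 1 ≤ p.amplification := by
  have := hp.cγ
  have := hp.cβ
  have := hp.RK
  exact le_add_of_nonneg_right (by positivity)

theorem one_le_c0 : 1 ≤ p.c0 :=
  one_le_mul_of_one_le_of_one_le hp.one_le_amplification (by linarith [hp.spread_pos, hp.RK])

theorem c0_lt_c1 (hR : 0 ≤ p.Rdyn) : p.c0 < p.c1 :=
  mul_lt_mul_of_pos_left (by linarith) (zero_lt_one.trans_le hp.one_le_amplification)

theorem le_of_lt_c2 (hε : ε < p.c2) : ε ≤ 1 ∧ ε ≤ p.radius :=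
  ⟨(hε.trans_le (min_le_left _ _)).le, (hε.trans_le (min_le_right _ _)).le.trans
    (div_le_self hp.radius_pos.le (le_max_left _ _))⟩

theorem actTol_mul : p.actTol ε * (1 + p.spread + p.RK) = p.inputTol ε := by
  have : 0 < 1 + p.spread + p.RK := by linarith [hp.spread_pos, hp.RK]
  rw [actTol, inputTol, c0, div_mul_eq_div_div, div_mul_cancel₀ _ this.ne']

theorem amplification_mul_inputTol : p.amplification * p.inputTol ε = ε :=
  mul_div_cancel₀ _ (zero_lt_one.trans_le hp.one_le_amplification).ne'

theorem inputTol_nonneg (hε : 0 ≤ ε) : 0 ≤ p.inputTol ε :=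
  div_nonneg hε (zero_le_one.trans hp.one_le_amplification)

theorem inputTol_le (hε : 0 ≤ ε) : p.inputTol ε ≤ ε := div_le_self hε hp.one_le_amplification

theorem stateTol_nonneg (hε : 0 ≤ ε) : 0 ≤ p.stateTol ε :=
  mul_nonneg (mul_nonneg zero_le_two hp.cγ.le) (hp.inputTol_nonneg hε)

theorem mul_inputTol_le_spread (hε : 0 ≤ ε) (hεr : ε ≤ p.radius) :
    3 * p.cγ * p.cβ * p.inputTol ε ≤ p.spread := by
  have hγU := mul_le_mul_of_nonneg_left ((hp.inputTol_le hε).trans hεr) hp.cγ.le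
  have := mul_le_mul_of_nonneg_left
    (show 3 * (p.cγ * p.inputTol ε) ≤ 4 * p.cγ * p.radius + p.cξ by
      linarith [mul_pos hp.cγ hp.radius_pos, hp.cξ]) hp.cβ.le
  rw [spread]
  linarith

theorem mul_inputTol_le (hε : 0 ≤ ε) : 3 * p.cγ * p.cβ * p.inputTol ε ≤ ε := by
  have hx := mul_nonneg (mul_pos hp.cγ hp.cβ).le (hp.inputTol_nonneg hε)
  have := hp.amplification_mul_inputTol (ε := ε)
  rw [amplification] at this
  linarith [mul_nonneg hp.RK hx, hp.inputTol_nonneg hε]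

theorem RK_mul_add_inputTol_le (hε : 0 ≤ ε) :
    p.RK * (3 * p.cγ * p.cβ * p.inputTol ε) + p.inputTol ε ≤ ε := by
  have hx := mul_nonneg (mul_pos hp.cγ hp.cβ).le (hp.inputTol_nonneg hε)
  have := hp.amplification_mul_inputTol (ε := ε)
  rw [amplification] at this
  linarith [mul_nonneg hp.RK hx]

theorem actTol_le_one (hε : ε ≤ 1) : p.actTol ε ≤ 1 :=
  div_le_one_of_le₀ (hε.trans hp.one_le_c0) (zero_le_one.trans hp.one_le_c0)

theorem stateTol_le (hε : 0 ≤ ε) (hεr : ε ≤ p.radius) : p.stateTol ε ≤ p.cξ := by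
  have hγ := hp.cγ
  have hε4 : ε * (4 * p.cγ) ≤ p.cξ := (le_div_iff₀ (by positivity)).1 (hεr.trans (min_le_right _ _))
  have := mul_le_mul_of_nonneg_left (hp.inputTol_le hε) hγ.le
  rw [stateTol]
  nlinarith

theorem gain_monotone : Monotone p.gain := fun _ _ h => mul_le_mul_of_nonneg_left h hp.cγ.le

theorem decay_le {x : ℝ} (hx : 0 ≤ x) (k : ℕ) : p.decay x (k + 1) ≤ p.cβ * x := by
  have hexp : Real.exp (-(p.L * k)) ≤ 1 :=
    Real.exp_le_one_iff.2 (neg_nonpos.2 (mul_nonneg hp.L.le k.cast_nonneg))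
  have := mul_le_mul_of_nonneg_left hexp (mul_nonneg hp.cβ.le hx)
  simp only [decay, Nat.cast_add, Nat.cast_one, add_sub_cancel_right]
  linarith

/-- The constant `c3` is chosen for this: after `c3` steps the decay at least halves a deviation. -/
theorem decay_le_half {x : ℝ} (hx : 0 ≤ x) {k : ℕ} (hk : p.c3 ≤ k) :
    p.decay x (k + 1) ≤ x / 2 := by
  have hβ := hp.cβ
  have hlog : Real.log (2 * Real.exp 1 * p.cβ) ≤ p.L * k := by
    rw [mul_comm p.L]
    exact (div_le_iff₀ hp.L).1 hk
  have hexp : 2 * Real.exp 1 * p.cβ ≤ Real.exp (p.L * k) :=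
    (Real.log_le_iff_le_exp (by positivity)).1 hlog
  have hhalf : p.cβ * Real.exp (-(p.L * k)) ≤ 1 / 2 := by
    rw [Real.exp_neg, ← div_eq_mul_inv, div_le_iff₀ (Real.exp_pos _)]
    nlinarith [Real.one_le_exp zero_le_one]
  simp only [decay, Nat.cast_add, Nat.cast_one, add_sub_cancel_right]
  linarith [mul_le_mul_of_nonneg_right hhalf hx]

end Positive

end StabParams

theorem subsingleton_or_one_le_of_isLocalTISS {p : StabParams} (hp : p.Positive)
    (ha : IsLocalTISS f p.gain p.decay p.cu p.cξ a ξ) : Subsingleton (Vec dx) ∨ 1 ≤ p.cβ := by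
  rcases subsingleton_or_nontrivial (Vec dx) with hs | _
  · exact Or.inl hs
  obtain ⟨v, hv⟩ := exists_norm_eq (Vec dx) hp.cξ.le
  have hiss := ha ξ (ξ + v) 0 (by simpa using hp.cξ.le) (by simp [hv])
    (fun _ => by simpa using hp.cu.le) 0 (Nat.zero_le _)
  have hle : p.cξ ≤ p.cβ * p.cξ := by
    simpa [rollout, StabParams.gain, StabParams.decay, hv] using hiss
  exact Or.inr ((le_mul_iff_one_le_left hp.cξ).1 hle)

theorem ctrl_dist_le_dMax (a b : CompAct dx du τ) (k : Fin τ) :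
    nndist (a k).1 (b k).1 + nndist (a k).2.1 (b k).2.1 + nndist (a k).2.2 (b k).2.2 ≤ dMax a b :=
  Finset.le_sup (f := fun k => nndist (a k).1 (b k).1 + nndist (a k).2.1 (b k).2.1 +
    nndist (a k).2.2 (b k).2.2) (mem_univ k)

section CloseActions

variable {p : StabParams} {ε : ℝ}

theorem norm_inputGap_le (hp : p.Positive) (hε : ε ≤ 1)
    (hcons : ∀ k : Fin τ, (a k).2.1 = rollout f a 0 ξ k) (hK : ∀ k, ‖(a k).2.2‖ ≤ p.RK)
    (hab : (dMax a b : ℝ) ≤ p.actTol ε) {k : Fin τ}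
    (hk : ‖rollout f a 0 ξ k - rollout f b 0 ξ' k‖ ≤ p.spread) :
    ‖inputGap f a b ξ' k‖ ≤ p.inputTol ε := by
  rw [← hp.actTol_mul]
  exact norm_applyCtrl_sub_le ((mod_cast ctrl_dist_le_dMax a b k : _ ≤ (dMax a b : ℝ)).trans hab)
    (hp.actTol_le_one hε) (hK k) (by rwa [hcons, norm_sub_rev])

variable (hp : p.Positive) (hε0 : 0 ≤ ε) (hε1 : ε ≤ 1) (hεr : ε ≤ p.radius)
  (ha : IsLocalTISS f p.gain p.decay p.cu p.cξ a ξ)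
  (hcons : ∀ k : Fin τ, (a k).2.1 = rollout f a 0 ξ k) (hK : ∀ k, ‖(a k).2.2‖ ≤ p.RK)
  (hξ : ‖ξ - ξ'‖ ≤ p.stateTol ε) (hab : (dMax a b : ℝ) ≤ p.actTol ε)
include hp hε0 hε1 hεr ha hcons hK hξ hab

theorem norm_rollout_sub_le_decay (hβ : 1 ≤ p.cβ) {k : ℕ} (hk : k ≤ τ) :
    ‖rollout f a 0 ξ k - rollout f b 0 ξ' k‖ ≤
      p.decay ‖ξ - ξ'‖ (k + 1) + p.cγ * p.inputTol ε := by
  have hUr : p.inputTol ε ≤ p.radius := (hp.inputTol_le hε0).trans hεr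
  refine ha.norm_rollout_sub_le_of_bootstrap hp.gain_monotone (hξ.trans (hp.stateTol_le hε0 hεr))
    (hp.inputTol_nonneg hε0) (hUr.trans (min_le_left _ _)) (R := p.spread) (fun k _ => ?_)
    (fun k => norm_inputGap_le hp hε1 hcons hK hab) hk
  calc p.decay ‖ξ - ξ'‖ (k + 1) + p.cγ * p.inputTol ε
      ≤ p.cβ * p.stateTol ε + p.cβ * (p.cγ * p.inputTol ε) :=
        add_le_add ((hp.decay_le (norm_nonneg _) k).trans
            (mul_le_mul_of_nonneg_left hξ hp.cβ.le))
          (le_mul_of_one_le_left (mul_nonneg hp.cγ.le (hp.inputTol_nonneg hε0)) hβ)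
    _ = 3 * p.cγ * p.cβ * p.inputTol ε := by rw [StabParams.stateTol]; ring
    _ ≤ p.spread := hp.mul_inputTol_le_spread hε0 hεr

theorem norm_rollout_sub_le_inputTol {k : ℕ} (hk : k ≤ τ) :
    ‖rollout f a 0 ξ k - rollout f b 0 ξ' k‖ ≤ 3 * p.cγ * p.cβ * p.inputTol ε := by
  have hU := mul_nonneg hp.cγ.le (hp.inputTol_nonneg hε0)
  rcases subsingleton_or_one_le_of_isLocalTISS hp ha with _ | hβ
  · rw [Subsingleton.elim (rollout f a 0 ξ k) (rollout f b 0 ξ' k), sub_self, norm_zero]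
    linarith [mul_nonneg hp.cβ.le hU]
  · have hdecay := (hp.decay_le (norm_nonneg (ξ - ξ')) k).trans
      (mul_le_mul_of_nonneg_left hξ hp.cβ.le)
    have := norm_rollout_sub_le_decay hp hε0 hε1 hεr ha hcons hK hξ hab hβ hk
    rw [StabParams.stateTol] at hdecay
    linarith [le_mul_of_one_le_left hU hβ]

theorem norm_rollout_sub_le_stateTol (hτ : p.c3 ≤ τ) :
    ‖rollout f a 0 ξ τ - rollout f b 0 ξ' τ‖ ≤ p.stateTol ε := by
  rcases subsingleton_or_one_le_of_isLocalTISS hp ha with _ | hβ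
  · rw [Subsingleton.elim (rollout f a 0 ξ τ) (rollout f b 0 ξ' τ), sub_self, norm_zero]
    exact hp.stateTol_nonneg hε0
  · have hhalf := hp.decay_le_half (norm_nonneg (ξ - ξ')) hτ
    have := norm_rollout_sub_le_decay hp hε0 hε1 hεr ha hcons hK hξ hab hβ le_rfl
    rw [StabParams.stateTol] at hξ ⊢
    linarith

end CloseActions

end ChunkStability

/-! ### Couplings and subcouplings -/

section Couplings

variable {X A B : Type*} [MeasurableSpace X] [MeasurableSpace A] [MeasurableSpace B]

theorem IsCoupling.isProbabilityMeasure {P : Measure A} {Q : Measure B} {μ : Measure (A × B)}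
    [IsProbabilityMeasure P] (h : IsCoupling μ P Q) : IsProbabilityMeasure μ :=
  ⟨by rw [← Set.preimage_univ (f := Prod.fst), ← Measure.map_apply measurable_fst .univ, h.1,
    measure_univ]⟩

theorem isMarkovKernel_of_isCoupling {P : Kernel X A} {Q : Kernel X B} {κ : Kernel X (A × B)}
    [IsMarkovKernel P] (h : ∀ x, IsCoupling (κ x) (P x) (Q x)) : IsMarkovKernel κ :=
  ⟨fun x => (h x).isProbabilityMeasure⟩

theorem IsCoupling.add {P P' : Measure A} {Q Q' : Measure B} {μ μ' : Measure (A × B)}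
    (h : IsCoupling μ P Q) (h' : IsCoupling μ' P' Q') :
    IsCoupling (μ + μ') (P + P') (Q + Q') :=
  ⟨by rw [Measure.map_add _ _ measurable_fst, h.1, h'.1],
    by rw [Measure.map_add _ _ measurable_snd, h.2, h'.2]⟩

theorem isCoupling_inv_smul_prod {P : Measure A} {Q : Measure B} [IsFiniteMeasure P]
    [IsFiniteMeasure Q] (h : P Set.univ = Q Set.univ) :
    IsCoupling ((P Set.univ)⁻¹ • P.prod Q) P Q := by
  rcases eq_or_ne (P Set.univ) 0 with h0 | h0
  · have hQ0 : Q Set.univ = 0 := h ▸ h0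
    simp [IsCoupling, Measure.measure_univ_eq_zero.1 h0, Measure.measure_univ_eq_zero.1 hQ0]
  · have hinv : (P Set.univ)⁻¹ * P Set.univ = 1 := ENNReal.inv_mul_cancel h0 (measure_ne_top _ _)
    constructor
    · rw [Measure.map_smul, Measure.map_fst_prod, smul_smul, ← h, hinv, one_smul]
    · rw [Measure.map_smul, Measure.map_snd_prod, smul_smul, hinv, one_smul]

/-- The least probability of the event `S` under a coupling of `P` and `Q` (an infimum). -/
noncomputable def couplingProb (S : Set (A × B)) (P : Measure A) (Q : Measure B) : ℝ≥0∞ :=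
  ⨅ (μ : Measure (A × B)) (_ : IsCoupling μ P Q), μ S

theorem couplingProb_le {P : Measure A} {Q : Measure B} {μ : Measure (A × B)}
    (h : IsCoupling μ P Q) (S : Set (A × B)) : couplingProb S P Q ≤ μ S :=
  iInf₂_le μ h

theorem couplingProb_mono {S T : Set (A × B)} (h : S ⊆ T) (P : Measure A) (Q : Measure B) :
    couplingProb S P Q ≤ couplingProb T P Q :=
  iInf₂_mono fun _ _ => measure_mono h

/-- `μ` is a subcoupling of `P` and `Q`: a partial transport plan, whose marginals are dominated
by `P` and `Q`. -/
def IsSubcoupling (μ : Measure (A × B)) (P : Measure A) (Q : Measure B) : Prop :=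
  μ.map Prod.fst ≤ P ∧ μ.map Prod.snd ≤ Q

theorem IsSubcoupling.mono {P : Measure A} {Q : Measure B} {μ ν : Measure (A × B)}
    (h : IsSubcoupling μ P Q) (hν : ν ≤ μ) : IsSubcoupling ν P Q :=
  ⟨(Measure.map_mono hν measurable_fst).trans h.1, (Measure.map_mono hν measurable_snd).trans h.2⟩

theorem IsCoupling.isSubcoupling {P : Measure A} {Q : Measure B} {μ : Measure (A × B)}
    (h : IsCoupling μ P Q) : IsSubcoupling μ P Q :=
  ⟨h.1.le, h.2.le⟩

theorem IsSubcoupling.measure_univ_le {P : Measure A} {Q : Measure B} {μ : Measure (A × B)}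
    (h : IsSubcoupling μ P Q) : μ Set.univ ≤ P Set.univ := by
  simpa only [Measure.map_apply measurable_fst .univ, Set.preimage_univ] using h.1 Set.univ

theorem IsSubcoupling.isCoupling_add_residual {P : Measure A} {Q : Measure B} {μ : Measure (A × B)}
    [IsProbabilityMeasure P] [IsProbabilityMeasure Q] (h : IsSubcoupling μ P Q) :
    IsCoupling (μ + (1 - μ Set.univ)⁻¹ • (P - μ.map Prod.fst).prod (Q - μ.map Prod.snd)) P Q := by
  have : IsFiniteMeasure μ :=
    ⟨h.measure_univ_le.trans_lt (measure_lt_top P _)⟩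
  have hP : (P - μ.map Prod.fst) Set.univ = 1 - μ Set.univ := by
    rw [Measure.sub_apply .univ h.1, Measure.map_apply measurable_fst .univ, Set.preimage_univ,
      measure_univ]
  have hQ : (Q - μ.map Prod.snd) Set.univ = 1 - μ Set.univ := by
    rw [Measure.sub_apply .univ h.2, Measure.map_apply measurable_snd .univ, Set.preimage_univ,
      measure_univ]
  have hμ : IsCoupling μ (μ.map Prod.fst) (μ.map Prod.snd) := ⟨rfl, rfl⟩
  have := hμ.add (isCoupling_inv_smul_prod (hP.trans hQ.symm))
  rwa [hP, add_comm (μ.map Prod.fst), add_comm (μ.map Prod.snd),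
    Measure.sub_add_cancel_of_le h.1, Measure.sub_add_cancel_of_le h.2] at this

theorem measurable_measure_sub {P Q : X → Measure A} (hP : Measurable P) (hQ : Measurable Q)
    [∀ x, IsFiniteMeasure (Q x)] (hle : ∀ x, Q x ≤ P x) : Measurable fun x => P x - Q x := by
  refine Measure.measurable_of_measurable_coe _ fun s hs => ?_
  simp_rw [fun x => Measure.sub_apply (μ := P x) (ν := Q x) hs (hle x)]
  exact ((Measure.measurable_coe hs).comp hP).sub ((Measure.measurable_coe hs).comp hQ)

theorem exists_coupling_kernel_ge {P : Kernel X A} {Q : Kernel X B} [IsMarkovKernel P]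
    [IsMarkovKernel Q] {ξ : Kernel X (A × B)} (hξ : ∀ x, IsSubcoupling (ξ x) (P x) (Q x)) :
    ∃ κ : Kernel X (A × B), (∀ x, IsCoupling (κ x) (P x) (Q x)) ∧ ∀ x, ξ x ≤ κ x := by
  have : ∀ x, IsFiniteMeasure (ξ x) := fun x =>
    ⟨(hξ x).measure_univ_le.trans_lt (measure_lt_top _ _)⟩
  let P' : Kernel X A := ⟨fun x => P x - (ξ x).map Prod.fst, measurable_measure_sub P.measurable
    ((Measure.measurable_map _ measurable_fst).comp ξ.measurable) fun x => (hξ x).1⟩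
  let Q' : Kernel X B := ⟨fun x => Q x - (ξ x).map Prod.snd, measurable_measure_sub Q.measurable
    ((Measure.measurable_map _ measurable_snd).comp ξ.measurable) fun x => (hξ x).2⟩
  have : IsFiniteKernel P' := ⟨1, ENNReal.one_lt_top, fun x =>
    (Measure.sub_le _).trans_eq measure_univ⟩
  have : IsFiniteKernel Q' := ⟨1, ENNReal.one_lt_top, fun x =>
    (Measure.sub_le _).trans_eq measure_univ⟩
  have hmass : Measurable fun x => (1 - ξ x Set.univ)⁻¹ :=
    (measurable_const.sub (ξ.measurable_coe .univ)).inv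
  refine ⟨⟨fun x => ξ x + (1 - ξ x Set.univ)⁻¹ • (P' x).prod (Q' x), ?_⟩,
    fun x => (hξ x).isCoupling_add_residual, fun x => Measure.le_add_right le_rfl⟩
  refine Measure.measurable_of_measurable_coe _ fun s hs => ?_
  have hprod := (P' ×ₖ Q').measurable_coe hs
  simp only [Kernel.prod_apply] at hprod
  simp only [Measure.add_apply, Measure.smul_apply, smul_eq_mul]
  exact (ξ.measurable_coe hs).add (hmass.mul hprod)

theorem measure_le_add_of_common_part {ξ μ ν : Measure A} [IsFiniteMeasure μ] (hμ : ξ ≤ μ)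
    (hν : ξ ≤ ν) {t : ℝ≥0∞} (hξ : μ Set.univ ≤ ξ Set.univ + t) {G : Set A}
    (hG : MeasurableSet G) : μ G ≤ ν G + t := by
  refine (ENNReal.add_le_add_iff_right (measure_ne_top μ Gᶜ)).1 ?_
  calc μ G + μ Gᶜ ≤ ξ G + ξ Gᶜ + t := by
        rwa [measure_add_measure_compl hG, measure_add_measure_compl hG]
    _ ≤ ν G + μ Gᶜ + t := by gcongr
    _ = ν G + t + μ Gᶜ := add_right_comm _ _ _

end Couplings

/-! ### Total variation -/

section TotalVariation

variable {X A B : Type*} [MeasurableSpace X] [MeasurableSpace A] [MeasurableSpace B]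

theorem measureReal_sub_le_tvDist (P Q : Measure A) [IsProbabilityMeasure P]
    [IsProbabilityMeasure Q] {S : Set A} (hS : MeasurableSet S) :
    P.real S - Q.real S ≤ tvDist P Q := by
  refine (le_abs_self _).trans (le_ciSup (f := fun S : {S : Set A // MeasurableSet S} =>
    |P.real S.1 - Q.real S.1|) ⟨1, ?_⟩ ⟨S, hS⟩)
  rintro _ ⟨T, rfl⟩
  exact abs_sub_le_of_nonneg_of_le measureReal_nonneg measureReal_le_one measureReal_nonneg
    measureReal_le_one

theorem measure_le_add_tvDist (P Q : Measure A) [IsProbabilityMeasure P]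
    [IsProbabilityMeasure Q] {S : Set A} (hS : MeasurableSet S) :
    P S ≤ Q S + ENNReal.ofReal (tvDist P Q) := by
  rw [← ofReal_measureReal (μ := P), ← ofReal_measureReal (μ := Q)]
  calc ENNReal.ofReal (P.real S) ≤ ENNReal.ofReal (Q.real S + tvDist P Q) :=
        ENNReal.ofReal_le_ofReal (by linarith [measureReal_sub_le_tvDist P Q hS])
    _ ≤ _ := ENNReal.ofReal_add_le

theorem one_le_lintegral_min_rnDeriv_add_tvDist (Q Q' : Measure A) [IsProbabilityMeasure Q]
    [IsProbabilityMeasure Q'] :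
    1 ≤ ∫⁻ b, min 1 (Q'.rnDeriv Q b) ∂Q + ENNReal.ofReal (tvDist Q Q') := by
  obtain ⟨N, hN, hsing, hNc⟩ := Q'.mutuallySingular_singularPart Q
  -- `S` is where `Q` exceeds `Q'`, up to the `Q`-null set `Nᶜ` carrying the singular part.
  set S : Set A := {b | Q'.rnDeriv Q b < 1} ∩ N
  have hS : MeasurableSet S :=
    (measurableSet_lt (Measure.measurable_rnDeriv _ _) measurable_const).inter hN
  have hQ'S : ∫⁻ b in S, min 1 (Q'.rnDeriv Q b) ∂Q = Q' S := by
    rw [setLIntegral_congr_fun hS fun b hb => min_eq_right hb.1.le]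
    conv_rhs => rw [Measure.haveLebesgueDecomposition_add Q' Q]
    rw [Measure.add_apply, measure_mono_null Set.inter_subset_right hsing, zero_add,
      withDensity_apply _ hS]
  have hQSc : ∫⁻ b in Sᶜ, min 1 (Q'.rnDeriv Q b) ∂Q = Q Sᶜ := by
    have hmin : ∀ᵐ b ∂Q, b ∈ Sᶜ → min 1 (Q'.rnDeriv Q b) = 1 := by
      filter_upwards [measure_eq_zero_iff_ae_notMem.1 hNc] with b hb hbS
      exact min_eq_left (not_lt.1 fun h => hbS ⟨h, not_not.1 hb⟩)
    rw [setLIntegral_congr_fun_ae hS.compl hmin, setLIntegral_one]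
  rw [← lintegral_add_compl _ hS, hQ'S, hQSc]
  calc 1 = Q S + Q Sᶜ := by rw [measure_add_measure_compl hS, measure_univ]
    _ ≤ Q' S + ENNReal.ofReal (tvDist Q Q') + Q Sᶜ := by
        gcongr; exact measure_le_add_tvDist Q Q' hS
    _ = _ := add_right_comm _ _ _

theorem exists_coupling_kernel_tvDist [MeasurableSpace.CountablyGenerated B] {P : Kernel X A}
    {Q Q' : Kernel X B} [IsMarkovKernel P] [IsMarkovKernel Q] [IsMarkovKernel Q']
    {K : Kernel X (A × B)} (hK : ∀ x, IsCoupling (K x) (P x) (Q x)) :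
    ∃ κ : Kernel X (A × B), (∀ x, IsCoupling (κ x) (P x) (Q' x)) ∧ ∀ x G, MeasurableSet G →
        κ x G ≤ K x G + ENNReal.ofReal (tvDist (Q x) (Q' x)) := by
  have := isMarkovKernel_of_isCoupling hK
  -- Keep the part of `K` whose second coordinate can be served by `Q'` as well.
  let w : X → A × B → ℝ≥0∞ := fun x z => min 1 (Kernel.rnDeriv Q' Q x z.2)
  have hw : Measurable (Function.uncurry w) :=
    measurable_const.min ((Kernel.measurable_rnDeriv Q' Q).comp
      (measurable_fst.prodMk measurable_snd.snd))
  have hξ : ∀ x, (K.withDensity w) x = (K x).withDensity (w x) := Kernel.withDensity_apply _ hw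
  have hξK : ∀ x, (K.withDensity w) x ≤ K x := fun x => by
    rw [hξ]
    exact (withDensity_mono (ae_of_all _ fun z => min_le_left _ _)).trans withDensity_one.le
  have hmin : ∀ x, Measurable fun b => min 1 (Kernel.rnDeriv Q' Q x b) := fun x =>
    measurable_const.min (Kernel.measurable_rnDeriv_right Q' Q x)
  have hsnd : ∀ x s, MeasurableSet s → (K.withDensity w) x (Prod.snd ⁻¹' s) =
      ∫⁻ b in s, min 1 (Kernel.rnDeriv Q' Q x b) ∂(Q x) := fun x s hs => by
    rw [hξ, withDensity_apply _ (measurable_snd hs), ← (hK x).2,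
      setLIntegral_map hs (hmin x) measurable_snd]
  have hsub : ∀ x, IsSubcoupling ((K.withDensity w) x) (P x) (Q' x) := fun x => by
    refine ⟨(Measure.map_mono (hξK x) measurable_fst).trans (hK x).1.le,
      Measure.le_iff.2 fun s hs => ?_⟩
    rw [Measure.map_apply measurable_snd hs, hsnd x s hs]
    exact (lintegral_mono fun b => min_le_right _ _).trans (Kernel.setLIntegral_rnDeriv_le hs)
  have hmass : ∀ x, 1 ≤ (K.withDensity w) x Set.univ + ENNReal.ofReal (tvDist (Q x) (Q' x)) := by
    intro x
    rw [← Set.preimage_univ (f := Prod.snd), hsnd x _ .univ, setLIntegral_univ]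
    convert one_le_lintegral_min_rnDeriv_add_tvDist (Q x) (Q' x) using 2
    refine lintegral_congr_ae ?_
    filter_upwards [Kernel.rnDeriv_eq_rnDeriv_measure (κ := Q') (η := Q) (a := x)] with b hb
    rw [hb]
  obtain ⟨κ, hκ, hξκ⟩ := exists_coupling_kernel_ge hsub
  have := isMarkovKernel_of_isCoupling hκ
  exact ⟨κ, hκ, fun x G hG => measure_le_add_of_common_part (hξκ x) (hξK x)
    (measure_univ.trans_le (hmass x)) hG⟩

theorem IsCoupling.abs_measureReal_sub_le {P Q : Measure A} {μ : Measure (A × A)}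
    [IsFiniteMeasure μ] (h : IsCoupling μ P Q) {S : Set A} (hS : MeasurableSet S) :
    |P.real S - Q.real S| ≤ μ.real {z | z.1 ≠ z.2} := by
  have hP : P.real S = μ.real (Prod.fst ⁻¹' S) := by
    rw [← h.1, map_measureReal_apply measurable_fst hS]
  have hQ : Q.real S = μ.real (Prod.snd ⁻¹' S) := by
    rw [← h.2, map_measureReal_apply measurable_snd hS]
  have hbound : ∀ s t : Set (A × A), s ⊆ t ∪ {z | z.1 ≠ z.2} →
      μ.real s ≤ μ.real t + μ.real {z | z.1 ≠ z.2} := fun s t hst =>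
    (measureReal_mono hst).trans (measureReal_union_le _ _)
  rw [hP, hQ, abs_sub_le_iff, sub_le_iff_le_add', sub_le_iff_le_add']
  constructor <;> refine hbound _ _ fun z hz => ?_ <;>
    · by_cases hne : z.1 = z.2
      · exact Or.inl (by simpa [hne] using hz)
      · exact Or.inr hne

theorem ofReal_tvDist_le_couplingProb_ne (P Q : Measure A) [IsProbabilityMeasure P] :
    ENNReal.ofReal (tvDist P Q) ≤ couplingProb {z | z.1 ≠ z.2} P Q := by
  refine le_iInf₂ fun μ hμ => ENNReal.ofReal_le_of_le_toReal ?_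
  have := hμ.isProbabilityMeasure
  have : Nonempty {S : Set A // MeasurableSet S} := ⟨⟨∅, .empty⟩⟩
  exact ciSup_le fun S => hμ.abs_measureReal_sub_le S.2

theorem exists_coupling_kernel_le_couplingProb_ne [MeasurableSpace.CountablyGenerated A]
    (P Q : Kernel X A) [IsMarkovKernel P] [IsMarkovKernel Q] {S : Set (A × A)}
    (hS : MeasurableSet S) (hdiag : ∀ a, (a, a) ∉ S) :
    ∃ κ : Kernel X (A × A), (∀ x, IsCoupling (κ x) (P x) (Q x)) ∧
      ∀ x, κ x S ≤ couplingProb {z | z.1 ≠ z.2} (P x) (Q x) := by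
  have hmeas : Measurable fun a : A => (a, a) := measurable_id.prodMk measurable_id
  have hK : ∀ x, IsCoupling (P.map (fun a => (a, a)) x) (P x) (P x) := fun x => by
    rw [Kernel.map_apply _ hmeas]
    exact ⟨by rw [Measure.map_map measurable_fst hmeas]; exact Measure.map_id,
      by rw [Measure.map_map measurable_snd hmeas]; exact Measure.map_id⟩
  obtain ⟨κ, hκ, hκS⟩ := exists_coupling_kernel_tvDist (Q' := Q) hK
  refine ⟨κ, hκ, fun x => (hκS x S hS).trans ?_⟩
  have hempty : (fun a : A => (a, a)) ⁻¹' S = ∅ := Set.eq_empty_iff_forall_notMem.2 hdiag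
  rw [Kernel.map_apply' _ hmeas _ hS, hempty, measure_empty, zero_add]
  exact ofReal_tvDist_le_couplingProb_ne _ _

end TotalVariation

/-! ### Measurable selection of nearly optimal couplings -/

section Selection

theorem exists_iSup_le_add {ι : Type*} [Nonempty ι] {f : ι → ℝ≥0∞} (hf : ⨆ i, f i ≠ ∞)
    {η : ℝ≥0∞} (hη : η ≠ 0) : ∃ i, ⨆ i, f i ≤ f i + η := by
  by_cases h0 : ⨆ i, f i = 0
  · exact ⟨Classical.arbitrary ι, by simp [h0]⟩
  · obtain ⟨i, hi⟩ := lt_iSup_iff.1 (ENNReal.sub_lt_self hf h0 hη)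
    exact ⟨i, tsub_le_iff_right.1 hi.le⟩

theorem exists_measurable_iSup_le_add {X : Type*} [MeasurableSpace X] {F : ℕ → X → ℝ≥0∞}
    (hF : ∀ n, Measurable (F n)) (hfin : ∀ x, ⨆ n, F n x ≠ ∞) {η : ℝ≥0∞} (hη : η ≠ 0) :
    ∃ s : X → ℕ, Measurable s ∧ ∀ x, ⨆ n, F n x ≤ F (s x) x + η := by
  classical
  have hex : ∀ x, ∃ n, ⨆ n, F n x ≤ F n x + η := fun x => exists_iSup_le_add (hfin x) hη
  exact ⟨fun x => Nat.find (hex x), measurable_find hex fun n =>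
    measurableSet_le (Measurable.iSup hF) ((hF n).add_const η), fun x => Nat.find_spec (hex x)⟩

section Countable

variable {T : Type*} [MeasurableSpace T] [MeasurableSingletonClass T]

/-- The measure with finitely many atoms whose masses are the rationals `t a`. A negative rational
counts as `0`. These measures form a countable family that is dense from below. -/
noncomputable def ratMeasure (t : T →₀ ℚ) : Measure T :=
  ∑ a ∈ t.support, ((t a : ℝ).toNNReal : ℝ≥0∞) • Measure.dirac a

theorem ratMeasure_singleton (t : T →₀ ℚ) (a : T) :
    ratMeasure t {a} = ((t a : ℝ).toNNReal : ℝ≥0∞) := by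
  classical
  simp only [ratMeasure, Measure.coe_finsetSum, Measure.coe_smul, Finset.sum_apply, Pi.smul_apply,
    Measure.dirac_apply, smul_eq_mul, Set.indicator_apply, Set.mem_singleton_iff, Pi.one_apply,
    mul_ite, mul_one, mul_zero, Finset.sum_ite_eq', Finsupp.mem_support_iff, ne_eq, ite_not]
  split_ifs with h <;> simp [h]

variable [Countable T]

theorem measure_le_iff_singleton {μ ν : Measure T} : μ ≤ ν ↔ ∀ a, μ {a} ≤ ν {a} := by
  refine ⟨fun h a => h {a}, fun h => Measure.le_iff.2 fun s hs => ?_⟩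
  rw [← Measure.tsum_indicator_apply_singleton μ s hs,
    ← Measure.tsum_indicator_apply_singleton ν s hs]
  exact ENNReal.tsum_le_tsum fun a => Set.indicator_le_indicator (h a)

theorem exists_rat_toNNReal_le {a : ℝ≥0∞} (ha : a ≠ ∞) {δ : ℝ≥0∞} (hδ : δ ≠ 0) :
    ∃ q : ℚ, ((q : ℝ).toNNReal : ℝ≥0∞) ≤ a ∧ a ≤ ((q : ℝ).toNNReal : ℝ≥0∞) + δ := by
  by_cases h0 : a = 0
  · exact ⟨0, by simp, by simp [h0]⟩
  · obtain ⟨q, -, hlt, hle⟩ := ENNReal.lt_iff_exists_rat_btwn.1 (ENNReal.sub_lt_self ha h0 hδ)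
    exact ⟨q, hle.le, tsub_le_iff_right.1 hlt.le⟩

theorem exists_ratMeasure_le (m : Measure T) [IsFiniteMeasure m] {η : ℝ≥0∞} (hη : η ≠ 0) :
    ∃ t : T →₀ ℚ, ratMeasure t ≤ m ∧ m Set.univ ≤ ratMeasure t Set.univ + η := by
  classical
  have hη2 : η / 2 ≠ 0 := by simpa using hη
  have hm : m Set.univ = ⨆ S : Finset T, m S := by
    simp_rw [← sum_measure_singleton, ← ENNReal.tsum_eq_iSup_sum]
    simpa using (lintegral_countable' (μ := m) 1)
  obtain ⟨S, hS⟩ := exists_iSup_le_add (hm ▸ measure_ne_top m _) hη2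
  obtain ⟨δ, hδ, hδη⟩ := ENNReal.exists_pos_sum_of_countable' hη2 T
  choose q hqm hmq using fun a => exists_rat_toNNReal_le (measure_ne_top m {a}) (hδ a).ne'
  let t : T →₀ ℚ := Finsupp.indicator S fun a _ => q a
  refine ⟨t, measure_le_iff_singleton.2 fun a => ?_, ?_⟩
  · rw [ratMeasure_singleton, Finsupp.indicator_apply]
    split_ifs
    · exact hqm a
    · simp
  · calc m Set.univ ≤ m S + η / 2 := hm.trans_le hS
      _ ≤ ∑ a ∈ S, (ratMeasure t {a} + δ a) + η / 2 := by
          rw [← sum_measure_singleton]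
          gcongr with a ha
          rw [ratMeasure_singleton, Finsupp.indicator_of_mem ha]
          exact hmq a
      _ ≤ ratMeasure t Set.univ + η / 2 + η / 2 := by
          rw [Finset.sum_add_distrib, sum_measure_singleton]
          gcongr
          · exact Set.subset_univ _
          · exact (ENNReal.sum_le_tsum S).trans hδη.le
      _ = ratMeasure t Set.univ + η := by rw [add_assoc, ENNReal.add_halves]

end Countable

section CountableLabels

variable {X I J : Type*} [MeasurableSpace X] [Countable I] [MeasurableSpace I]
  [MeasurableSingletonClass I] [Countable J] [MeasurableSpace J] [MeasurableSingletonClass J]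

theorem measurableSet_isSubcoupling (ν : Measure (I × J)) (P : Kernel X I) (Q : Kernel X J) :
    MeasurableSet {x | IsSubcoupling ν (P x) (Q x)} := by
  simp only [IsSubcoupling, measure_le_iff_singleton, Set.ofPred_and, Set.ofPred_forall]
  exact (MeasurableSet.iInter fun i => measurableSet_le measurable_const
      (P.measurable_coe (measurableSet_singleton i))).inter
    (MeasurableSet.iInter fun j => measurableSet_le measurable_const
      (Q.measurable_coe (measurableSet_singleton j)))

theorem exists_subcoupling_kernel_seq_dense (P : Kernel X I) (Q : Kernel X J) [IsFiniteKernel P] :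
    ∃ V : ℕ → Kernel X (I × J), (∀ n x, IsSubcoupling (V n x) (P x) (Q x)) ∧
      ∀ x μ, IsSubcoupling μ (P x) (Q x) → ∀ R, ∀ η ≠ 0, ∃ n, μ R ≤ V n x R + η := by
  classical
  obtain ⟨e, he⟩ := exists_surjective_nat (I × J →₀ ℚ)
  let V : ℕ → Kernel X (I × J) := fun n =>
    Kernel.piecewise (measurableSet_isSubcoupling (ratMeasure (e n)) P Q)
      (Kernel.const X (ratMeasure (e n))) 0
  refine ⟨V, fun n x => ?_, fun x μ hμ R η hη => ?_⟩
  · simp only [V, Kernel.piecewise_apply, Set.mem_ofPred_eq, Kernel.const_apply]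
    split_ifs with h
    · exact h
    · simp [IsSubcoupling, Measure.zero_le]
  · have : IsFiniteMeasure μ := ⟨hμ.measure_univ_le.trans_lt (measure_lt_top _ _)⟩
    obtain ⟨t, htμ, ht⟩ := exists_ratMeasure_le μ hη
    obtain ⟨n, rfl⟩ := he t
    have hn : V n x = ratMeasure (e n) := by
      simp only [V, Kernel.piecewise_apply, Set.mem_ofPred_eq, Kernel.const_apply,
        if_pos (hμ.mono htμ)]
    refine ⟨n, ?_⟩
    rw [hn]
    exact measure_le_add_of_common_part htμ le_rfl ht R.to_countable.measurableSet

theorem exists_subcoupling_kernel_near_max (P : Kernel X I) (Q : Kernel X J) [IsFiniteKernel P]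
    (R : Set (I × J)) {η : ℝ≥0∞} (hη : η ≠ 0) :
    ∃ W : Kernel X (I × J), (∀ x, IsSubcoupling (W x) (P x) (Q x)) ∧
      ∀ x μ, IsSubcoupling μ (P x) (Q x) → μ R ≤ W x R + η := by
  have hη2 : η / 2 ≠ 0 := by simpa using hη
  obtain ⟨V, hV, hV_dense⟩ := exists_subcoupling_kernel_seq_dense P Q
  have hfin : ∀ x, ⨆ n, V n x R ≠ ∞ := fun x =>
    ne_top_of_le_ne_top (measure_ne_top (P x) Set.univ) (iSup_le fun n =>
      (measure_mono (Set.subset_univ R)).trans (hV n x).measure_univ_le)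
  obtain ⟨s, hs, hs_max⟩ := exists_measurable_iSup_le_add
    (fun n => (V n).measurable_coe R.to_countable.measurableSet) hfin hη2
  have hW : Measurable fun x => V (s x) x :=
    (measurable_from_prod_countable_right (f := fun z : ℕ × X => V z.1 z.2)
      fun n => (V n).measurable).comp (hs.prodMk measurable_id)
  refine ⟨⟨fun x => V (s x) x, hW⟩, fun x => hV _ x, fun x μ hμ => ?_⟩
  obtain ⟨n, hn⟩ := hV_dense x μ hμ R _ hη2
  calc μ R ≤ V n x R + η / 2 := hn
    _ ≤ (V (s x) x R + η / 2) + η / 2 := by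
        gcongr
        exact (le_iSup (fun n => V n x R) n).trans (hs_max x)
    _ = V (s x) x R + η := by rw [add_assoc, ENNReal.add_halves]

end CountableLabels

end Selection

section Lift

variable {X A B I J : Type*} [MeasurableSpace X] [MeasurableSpace A] [MeasurableSpace B]
  [MeasurableSpace I] [MeasurableSpace J]

theorem map_withDensity_comp (μ : Measure A) {c : A → I} (hc : Measurable c) {v : I → ℝ≥0∞}
    (hv : Measurable v) : (μ.withDensity (v ∘ c)).map c = (μ.map c).withDensity v := by
  ext s hs
  rw [Measure.map_apply hc hs, withDensity_apply _ (hc hs), withDensity_apply _ hs,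
    setLIntegral_map hs hv hc, Function.comp_def]

theorem withDensity_comp_le {μ : Measure A} [SigmaFinite μ] {c : A → I} (hc : Measurable c)
    {v : I → ℝ≥0∞} (hv : Measurable v) [SigmaFinite (μ.map c)]
    (h : (μ.map c).withDensity v ≤ μ.map c) : μ.withDensity (v ∘ c) ≤ μ := by
  have hv1 : v ≤ᵐ[μ.map c] 1 :=
    ae_le_of_forall_setLIntegral_le_of_sigmaFinite hv fun s hs _ => by
      simpa only [withDensity_apply _ hs, Pi.one_apply, setLIntegral_one] using h s
  exact (withDensity_mono (ae_of_ae_map hc.aemeasurable hv1)).trans_eq withDensity_one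

theorem map_fst_withDensity_prod (P : Measure A) (Q : Measure B) [SFinite P] [SFinite Q]
    {φ : A × B → ℝ≥0∞} (hφ : Measurable φ) :
    ((P.prod Q).withDensity φ).map Prod.fst = P.withDensity fun a => ∫⁻ b, φ (a, b) ∂Q := by
  ext s hs
  rw [Measure.map_apply measurable_fst hs, withDensity_apply _ (measurable_fst hs),
    withDensity_apply _ hs, ← Set.prod_univ, setLIntegral_prod _ hφ.aemeasurable]
  simp only [Measure.restrict_univ]

theorem map_snd_withDensity_prod (P : Measure A) (Q : Measure B) [SFinite P] [SFinite Q]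
    {φ : A × B → ℝ≥0∞} (hφ : Measurable φ) :
    ((P.prod Q).withDensity φ).map Prod.snd = Q.withDensity fun b => ∫⁻ a, φ (a, b) ∂P := by
  ext s hs
  rw [Measure.map_apply measurable_snd hs, withDensity_apply _ (measurable_snd hs),
    withDensity_apply _ hs, ← Set.univ_prod, setLIntegral_prod_symm _ hφ.aemeasurable]
  simp only [Measure.restrict_univ]

theorem isSubcoupling_withDensity_comp_prodMap {P : Measure A} {Q : Measure B} [IsFiniteMeasure P]
    [IsFiniteMeasure Q] {c : A → I} {d : B → J} (hc : Measurable c) (hd : Measurable d)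
    {v : I × J → ℝ≥0∞} (hv : Measurable v)
    (h : IsSubcoupling (((P.map c).prod (Q.map d)).withDensity v) (P.map c) (Q.map d)) :
    IsSubcoupling ((P.prod Q).withDensity (v ∘ Prod.map c d)) P Q := by
  have hcd : Measurable (v ∘ Prod.map c d) := hv.comp (hc.prodMap hd)
  constructor
  · have hF : Measurable fun i => ∫⁻ j, v (i, j) ∂Q.map d := hv.lintegral_prod_right'
    convert withDensity_comp_le hc hF (by simpa only [map_fst_withDensity_prod _ _ hv] using h.1)
    rw [map_fst_withDensity_prod _ _ hcd]
    congr with a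
    exact (lintegral_map (hv.comp measurable_prodMk_left) hd).symm
  · have hF : Measurable fun j => ∫⁻ i, v (i, j) ∂P.map c := hv.lintegral_prod_left'
    convert withDensity_comp_le hd hF (by simpa only [map_snd_withDensity_prod _ _ hv] using h.2)
    rw [map_snd_withDensity_prod _ _ hcd]
    congr with b
    exact (lintegral_map (hv.comp measurable_prodMk_right) hc).symm

theorem IsSubcoupling.absolutelyContinuous_prod [Countable I] [MeasurableSingletonClass I]
    [Countable J] [MeasurableSingletonClass J] {p : Measure I} {q : Measure J} [SFinite q]
    {μ : Measure (I × J)} (h : IsSubcoupling μ p q) : μ ≪ p.prod q := by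
  have hfst : ∀ i j, μ {(i, j)} ≤ p {i} := fun i j =>
    ((measure_mono (by simp)).trans_eq (Measure.map_apply measurable_fst
      (measurableSet_singleton i)).symm).trans (h.1 {i})
  have hsnd : ∀ i j, μ {(i, j)} ≤ q {j} := fun i j =>
    ((measure_mono (by simp)).trans_eq (Measure.map_apply measurable_snd
      (measurableSet_singleton j)).symm).trans (h.2 {j})
  refine fun s hs => (measure_null_iff_singleton s.to_countable).2 fun ⟨i, j⟩ hij => ?_
  have hprod : p {i} * q {j} = 0 := by
    rw [← Measure.prod_prod, Set.singleton_prod_singleton]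
    exact measure_mono_null (Set.singleton_subset_iff.2 hij) hs
  rcases mul_eq_zero.1 hprod with hi | hj
  · exact le_antisymm (hi ▸ hfst i j) zero_le
  · exact le_antisymm (hj ▸ hsnd i j) zero_le

theorem exists_subcoupling_kernel_map_eq [Countable I] [MeasurableSingletonClass I]
    [Countable J] [MeasurableSingletonClass J] {P : Kernel X A} {Q : Kernel X B} [IsFiniteKernel P]
    [IsFiniteKernel Q] {c : A → I} {d : B → J} (hc : Measurable c) (hd : Measurable d)
    {W : Kernel X (I × J)} (hW : ∀ x, IsSubcoupling (W x) (P.map c x) (Q.map d x)) :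
    ∃ ξ : Kernel X (A × B), (∀ x, IsSubcoupling (ξ x) (P x) (Q x)) ∧
      ∀ x, (ξ x).map (Prod.map c d) = W x := by
  have : IsFiniteKernel W := ⟨(P.map c).bound, (P.map c).bound_lt_top, fun x =>
    (hW x).measure_univ_le.trans (Kernel.measure_le_bound _ x _)⟩
  let v : X → I × J → ℝ≥0∞ := Kernel.rnDeriv W (P.map c ×ₖ Q.map d)
  have hv : ∀ x, Measurable (v x) := Kernel.measurable_rnDeriv_right W _
  have hφ : Measurable (Function.uncurry fun x => v x ∘ Prod.map c d) :=
    (Kernel.measurable_rnDeriv W _).comp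
      (measurable_fst.prodMk ((hc.prodMap hd).comp measurable_snd))
  have hvW : ∀ x, (((P x).map c).prod ((Q x).map d)).withDensity (v x) = W x := fun x => by
    have hac := (hW x).absolutelyContinuous_prod
    rw [← Kernel.prod_apply] at hac
    rw [← Kernel.map_apply _ hc, ← Kernel.map_apply _ hd, ← Kernel.prod_apply,
      ← Kernel.withDensity_apply _ (Kernel.measurable_rnDeriv W _)]
    exact Kernel.withDensity_rnDeriv_eq hac
  have hξ : ∀ x, ((P ×ₖ Q).withDensity fun x => v x ∘ Prod.map c d) x =
      ((P x).prod (Q x)).withDensity (v x ∘ Prod.map c d) := fun x => by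
    rw [Kernel.withDensity_apply _ hφ, Kernel.prod_apply]
  refine ⟨(P ×ₖ Q).withDensity fun x => v x ∘ Prod.map c d, fun x => ?_, fun x => ?_⟩
  · have hWx := hW x
    rw [Kernel.map_apply _ hc, Kernel.map_apply _ hd, ← hvW] at hWx
    rw [hξ]
    exact isSubcoupling_withDensity_comp_prodMap hc hd (hv x) hWx
  · rw [hξ, map_withDensity_comp _ (hc.prodMap hd) (hv x), ← Measure.map_prod_map _ _ hc hd, hvW]

theorem IsSubcoupling.map_prodMap {P : Measure A} {Q : Measure B} {μ : Measure (A × B)}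
    (h : IsSubcoupling μ P Q) {c : A → I} {d : B → J} (hc : Measurable c) (hd : Measurable d) :
    IsSubcoupling (μ.map (Prod.map c d)) (P.map c) (Q.map d) := by
  constructor
  · rw [Measure.map_map measurable_fst (hc.prodMap hd), Prod.map_fst',
      ← Measure.map_map hc measurable_fst]
    exact Measure.map_mono h.1 hc
  · rw [Measure.map_map measurable_snd (hc.prodMap hd), Prod.map_snd',
      ← Measure.map_map hd measurable_snd]
    exact Measure.map_mono h.2 hd

theorem exists_coupling_kernel_cells [Countable I] [MeasurableSingletonClass I]
    [Countable J] [MeasurableSingletonClass J] (P : Kernel X A) (Q : Kernel X B) [IsMarkovKernel P]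
    [IsMarkovKernel Q] {c : A → I} {d : B → J} (hc : Measurable c) (hd : Measurable d)
    (R : Set (I × J)) {η : ℝ≥0∞} (hη : η ≠ 0) :
    ∃ κ : Kernel X (A × B), (∀ x, IsCoupling (κ x) (P x) (Q x)) ∧
      ∀ x, κ x (Prod.map c d ⁻¹' R) ≤ couplingProb (Prod.map c d ⁻¹' R) (P x) (Q x) + η := by
  have hcd : Measurable (Prod.map c d) := hc.prodMap hd
  have hR : MeasurableSet (Prod.map c d ⁻¹' R) := hcd R.to_countable.measurableSet
  obtain ⟨W, hW, hW_max⟩ := exists_subcoupling_kernel_near_max (P.map c) (Q.map d) Rᶜ hη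
  obtain ⟨ξ, hξ, hξW⟩ := exists_subcoupling_kernel_map_eq hc hd hW
  obtain ⟨κ, hκ, hξκ⟩ := exists_coupling_kernel_ge hξ
  have := isMarkovKernel_of_isCoupling hκ
  refine ⟨κ, hκ, fun x => tsub_le_iff_right.1 (le_iInf₂ fun μ hμ => tsub_le_iff_right.2 ?_)⟩
  have := hμ.isProbabilityMeasure
  have hmax : μ (Prod.map c d ⁻¹' R)ᶜ ≤ κ x (Prod.map c d ⁻¹' R)ᶜ + η :=
    calc μ (Prod.map c d ⁻¹' R)ᶜ = μ.map (Prod.map c d) Rᶜ :=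
          (Measure.map_apply hcd Rᶜ.to_countable.measurableSet).symm
      _ ≤ W x Rᶜ + η := hW_max x _ <| by
          rw [Kernel.map_apply _ hc, Kernel.map_apply _ hd]
          exact hμ.isSubcoupling.map_prodMap hc hd
      _ = ξ x (Prod.map c d ⁻¹' R)ᶜ + η := by
          rw [← hξW, Measure.map_apply hcd Rᶜ.to_countable.measurableSet, Set.preimage_compl]
      _ ≤ κ x (Prod.map c d ⁻¹' R)ᶜ + η := by gcongr; exact hξκ x
  refine (ENNReal.add_le_add_iff_right (measure_ne_top (κ x) (Prod.map c d ⁻¹' R)ᶜ)).1 ?_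
  calc κ x (Prod.map c d ⁻¹' R) + κ x (Prod.map c d ⁻¹' R)ᶜ
      = μ (Prod.map c d ⁻¹' R) + μ (Prod.map c d ⁻¹' R)ᶜ := by
        rw [measure_add_measure_compl hR, measure_add_measure_compl hR, measure_univ, measure_univ]
    _ ≤ μ (Prod.map c d ⁻¹' R) + (κ x (Prod.map c d ⁻¹' R)ᶜ + η) := by gcongr
    _ = μ (Prod.map c d ⁻¹' R) + η + κ x (Prod.map c d ⁻¹' R)ᶜ := by
        rw [add_left_comm, add_comm]

end Lift

section Metric

variable {X A B : Type*} [MeasurableSpace X] [PseudoMetricSpace A] [SecondCountableTopology A]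
  [MeasurableSpace A] [OpensMeasurableSpace A]

theorem exists_measurable_dist_lt {δ : ℝ} (hδ : 0 < δ) :
    ∃ c : A → ℕ, Measurable c ∧ ∀ a b, c a = c b → dist a b < δ := by
  classical
  rcases isEmpty_or_nonempty A with hA | hA
  · exact ⟨hA.elim, measurable_of_empty _, hA.elim⟩
  have hex : ∀ a : A, ∃ n, dist a (TopologicalSpace.denseSeq A n) < δ / 2 := fun a =>
    (TopologicalSpace.denseRange_denseSeq A).exists_dist_lt a (half_pos hδ)
  refine ⟨fun a => Nat.find (hex a), measurable_find hex fun n =>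
    measurableSet_lt (measurable_id.dist measurable_const) measurable_const, fun a b hab => ?_⟩
  have ha := Nat.find_spec (hex a)
  have hb := Nat.find_spec (hex b)
  simp only at hab
  rw [← hab] at hb
  linarith [dist_triangle_right a b (TopologicalSpace.denseSeq A (Nat.find (hex a)))]

variable [PseudoMetricSpace B] [SecondCountableTopology B] [MeasurableSpace B]
  [OpensMeasurableSpace B]

theorem exists_coupling_kernel_le_couplingProb (P : Kernel X A) (Q : Kernel X B) [IsMarkovKernel P]
    [IsMarkovKernel Q] {S T : Set (A × B)} {δ : ℝ} (hδ : 0 < δ) (hST : Metric.thickening δ S ⊆ T)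
    {η : ℝ≥0∞} (hη : η ≠ 0) :
    ∃ κ : Kernel X (A × B), (∀ x, IsCoupling (κ x) (P x) (Q x)) ∧
      ∀ x, κ x S ≤ couplingProb T (P x) (Q x) + η := by
  obtain ⟨c, hc, hcδ⟩ := exists_measurable_dist_lt (A := A) hδ
  obtain ⟨d, hd, hdδ⟩ := exists_measurable_dist_lt (A := B) hδ
  obtain ⟨κ, hκ, hκS⟩ := exists_coupling_kernel_cells P Q hc hd (Prod.map c d '' S) hη
  have hcells : Prod.map c d ⁻¹' (Prod.map c d '' S) ⊆ T := by
    rintro ⟨a, b⟩ ⟨⟨a', b'⟩, hS, hab⟩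
    obtain ⟨ha, hb⟩ := Prod.mk.injEq _ _ _ _ ▸ hab
    refine hST (Metric.mem_thickening_iff.2 ⟨(a', b'), hS, ?_⟩)
    exact max_lt (hcδ a a' ha.symm) (hdδ b b' hb.symm)
  exact ⟨κ, hκ, fun x => (measure_mono (Set.subset_preimage_image _ S)).trans ((hκS x).trans
    (by gcongr; exact couplingProb_mono hcells _ _))⟩

end Metric

/-! ### The distance between composite actions -/

section CompositeActions

variable {X : Type*} [MeasurableSpace X] {dx du τ : ℕ}

instance : StandardBorelSpace (CompAct dx du τ) :=
  have : StandardBorelSpace (PrimCtrl dx du) := inferInstance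
  StandardBorelSpace.pi_countable

instance : OpensMeasurableSpace (CompAct dx du τ × CompAct dx du τ) :=
  Prod.opensMeasurableSpace

theorem continuous_dMax :
    Continuous fun z : CompAct dx du τ × CompAct dx du τ => dMax z.1 z.2 := by
  unfold dMax
  refine Continuous.finset_sup_apply fun k _ => ?_
  fun_prop

theorem measurableSet_lt_dMax (r : ℝ) :
    MeasurableSet {z : CompAct dx du τ × CompAct dx du τ | r < (dMax z.1 z.2 : ℝ)} :=
  measurableSet_lt measurable_const continuous_dMax.measurable.coe_nnreal_real

theorem dMax_triangle (a b c : CompAct dx du τ) : dMax a c ≤ dMax a b + dMax b c := by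
  refine Finset.sup_le fun k _ =>
    le_trans ?_ (add_le_add (ctrl_dist_le_dMax a b k) (ctrl_dist_le_dMax b c k))
  rw [add_add_add_comm, add_add_add_comm (nndist (a k).1 (b k).1)]
  gcongr <;> exact nndist_triangle _ _ _

theorem dMax_le_three_mul_nndist (a b : CompAct dx du τ) : dMax a b ≤ 3 * nndist a b := by
  refine Finset.sup_le fun k _ => ?_
  have hk : max (nndist (a k).1 (b k).1)
      (max (nndist (a k).2.1 (b k).2.1) (nndist (a k).2.2 (b k).2.2)) ≤ nndist a b :=
    nndist_le_pi_nndist a b k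
  simp only [max_le_iff] at hk
  calc _ ≤ nndist a b + nndist a b + nndist a b := add_le_add (add_le_add hk.1 hk.2.1) hk.2.2
    _ = 3 * nndist a b := by ring

theorem dMax_self (a : CompAct dx du τ) : dMax a a = 0 := by
  simp [dMax]

theorem dMax_pos_iff {a b : CompAct dx du τ} : 0 < dMax a b ↔ a ≠ b := by
  refine pos_iff_ne_zero.trans (not_congr ⟨fun h => funext fun k => ?_, fun h => h ▸ dMax_self a⟩)
  have hk := h ▸ ctrl_dist_le_dMax a b k
  simp only [nonpos_iff_eq_zero, add_eq_zero, nndist_eq_zero] at hk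
  exact Prod.ext hk.1.1 (Prod.ext hk.1.2 hk.2)

theorem thickening_lt_dMax_subset (r r' : ℝ) :
    Metric.thickening ((r' - r) / 6)
        {z : CompAct dx du τ × CompAct dx du τ | r' < (dMax z.1 z.2 : ℝ)} ⊆
      {z | r < (dMax z.1 z.2 : ℝ)} := by
  rintro ⟨a, b⟩ hab
  obtain ⟨⟨a', b'⟩, hr', hdist⟩ := Metric.mem_thickening_iff.1 hab
  obtain ⟨ha, hb⟩ := max_lt_iff.1 (Prod.dist_eq (x := (a, b)) (y := (a', b')) ▸ hdist)
  have ha' : (dMax a' a : ℝ) ≤ 3 * dist a' a := mod_cast dMax_le_three_mul_nndist a' a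
  have hb' : (dMax b b' : ℝ) ≤ 3 * dist b b' := mod_cast dMax_le_three_mul_nndist b b'
  have htri : (dMax a' b' : ℝ) ≤ dMax a' a + (dMax a b + dMax b b') := mod_cast
    (dMax_triangle a' a b').trans (add_le_add_right (dMax_triangle a b b') _)
  simp only [Set.mem_ofPred_eq] at hr' ⊢
  rw [dist_comm a' a] at ha'
  linarith

theorem otProb_eq_couplingProb (r : ℝ) (P Q : Measure (CompAct dx du τ)) :
    otProb r P Q = couplingProb {z | r < (dMax z.1 z.2 : ℝ)} P Q := rfl

theorem exists_coupling_kernel_otProb (P Q : Kernel X (CompAct dx du τ)) [IsMarkovKernel P]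
    [IsMarkovKernel Q] {r r' : ℝ} (hr : r < r' ∨ r = 0 ∧ r' = 0) {η : ℝ≥0∞} (hη : η ≠ 0) :
    ∃ κ : Kernel X (CompAct dx du τ × CompAct dx du τ), (∀ x, IsCoupling (κ x) (P x) (Q x)) ∧
      ∀ x, κ x {z | r' < (dMax z.1 z.2 : ℝ)} ≤ otProb r (P x) (Q x) + η := by
  rcases hr with hr | ⟨rfl, rfl⟩
  · exact exists_coupling_kernel_le_couplingProb P Q (by linarith)
      (thickening_lt_dMax_subset r r') hη
  · obtain ⟨κ, hκ, hκ_ne⟩ := exists_coupling_kernel_le_couplingProb_ne P Q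
      (measurableSet_lt_dMax (dx := dx) (du := du) (τ := τ) 0) fun a => by simp [dMax_self]
    refine ⟨κ, hκ, fun x => (hκ_ne x).trans (le_add_right ?_)⟩
    simp only [otProb_eq_couplingProb, NNReal.coe_pos, dMax_pos_iff, le_refl]

theorem otProb_le_wass1 {r : ℝ} (hr : 0 < r) (P Q : Measure (CompAct dx du τ)) :
    otProb r P Q ≤ ENNReal.ofReal r⁻¹ * wass1 P Q := by
  rw [ENNReal.ofReal_inv_of_pos hr, mul_comm, ← div_eq_mul_inv,
    ENNReal.le_div_iff_mul_le (.inl (ENNReal.ofReal_pos.2 hr).ne') (.inl ENNReal.ofReal_ne_top),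
    mul_comm]
  refine le_iInf₂ fun μ hμ => ?_
  calc ENNReal.ofReal r * otProb r P Q ≤ ENNReal.ofReal r * μ {z | r < (dMax z.1 z.2 : ℝ)} := by
        gcongr; exact couplingProb_le hμ _
    _ ≤ ENNReal.ofReal r * μ {z | ENNReal.ofReal r ≤ (dMax z.1 z.2 : ℝ≥0∞)} := by
        gcongr with z
        intro hz
        exact ENNReal.ofReal_le_coe.2 hz.le
    _ ≤ ∫⁻ z, (dMax z.1 z.2 : ℝ≥0∞) ∂μ :=
        mul_meas_ge_le_lintegral continuous_dMax.measurable.coe_nnreal_ennreal _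

end CompositeActions

/-! ### Gluing -/

section Gluing

variable {Z W Y V O O' A A' : Type*} [MeasurableSpace Z] [MeasurableSpace W] [MeasurableSpace Y]
  [MeasurableSpace V] [MeasurableSpace O] [MeasurableSpace O'] [MeasurableSpace A]
  [MeasurableSpace A']

theorem map_prodMap_compProd {μ : Measure Z} [SFinite μ] {κ : Kernel Z W} [IsSFiniteKernel κ]
    {κ' : Kernel Y V} [IsSFiniteKernel κ'] {c : Z → Y} (hc : Measurable c) {d : W → V}
    (hd : Measurable d) (h : ∀ z, (κ z).map d = κ' (c z)) :
    (μ ⊗ₘ κ).map (Prod.map c d) = μ.map c ⊗ₘ κ' := by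
  ext s hs
  rw [Measure.map_apply (hc.prodMap hd) hs, Measure.compProd_apply (hc.prodMap hd hs),
    Measure.compProd_apply hs, lintegral_map (Kernel.measurable_kernel_prodMk_left hs) hc]
  refine lintegral_congr fun z => ?_
  rw [← h, Measure.map_apply hd (measurable_prodMk_left hs)]
  rfl

theorem compProd_imp_le {μ : Measure Z} [SFinite μ] {κ : Kernel Z W} [IsMarkovKernel κ]
    {G : Set Z} (hG : MeasurableSet G) {S : Set W} (hS : MeasurableSet S) {g : Z → ℝ≥0∞}
    (h : ∀ z ∈ G, κ z S ≤ g z) :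
    (μ ⊗ₘ κ) {y | y.1 ∈ G → y.2 ∈ S} ≤ μ Gᶜ + ∫⁻ z, g z ∂μ := by
  have hsub : {y : Z × W | y.1 ∈ G → y.2 ∈ S} ⊆ Gᶜ ×ˢ Set.univ ∪ G ×ˢ S := fun y hy =>
    (em (y.1 ∈ G)).elim (fun hG => .inr ⟨hG, hy hG⟩) fun hG => .inl ⟨hG, Set.mem_univ _⟩
  calc (μ ⊗ₘ κ) {y | y.1 ∈ G → y.2 ∈ S}
      ≤ (μ ⊗ₘ κ) (Gᶜ ×ˢ Set.univ) + (μ ⊗ₘ κ) (G ×ˢ S) :=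
        (measure_mono hsub).trans (measure_union_le _ _)
    _ = μ Gᶜ + ∫⁻ z in G, κ z S ∂μ := by
        simp only [Measure.compProd_apply_prod hG.compl .univ, Measure.compProd_apply_prod hG hS,
          measure_univ, setLIntegral_one]
    _ ≤ μ Gᶜ + ∫⁻ z, g z ∂μ := by
        refine add_le_add_right ?_ _
        exact (setLIntegral_mono' hG h).trans (setLIntegral_le_lintegral _ _)

theorem exists_coupling_map_prodMap_eq [StandardBorelSpace V] [Nonempty V] {D : Measure Z}
    [SFinite D] {g : Z → Y} (hg : Measurable g) {M : Measure (Y × V)} [IsFiniteMeasure M]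
    (hM : M.map Prod.fst = D.map g) :
    ∃ μ, IsCoupling μ D (M.map Prod.snd) ∧ μ.map (Prod.map g id) = M := by
  let μ : Measure (Z × V) := D ⊗ₘ M.condKernel.comap g hg
  have hμ : μ.map (Prod.map g id) = M := by
    rw [map_prodMap_compProd hg measurable_id (κ' := M.condKernel) fun z => Measure.map_id,
      ← hM]
    exact M.disintegrate M.condKernel
  refine ⟨μ, ⟨Measure.fst_compProd _ _, ?_⟩, hμ⟩
  rw [← hμ, Measure.map_map measurable_snd (hg.prodMap measurable_id)]
  rfl

/-- Only the observation of the first component is kept when the actions are drawn; the component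
itself is then glued back along its observation and its action. -/
theorem IsCoupling.exists_coupling_compProd_comap [StandardBorelSpace W] [StandardBorelSpace A']
    [Nonempty W] [Nonempty A'] {D : Measure Z} [IsProbabilityMeasure D] {L : Measure W}
    {ν : Measure (Z × W)} (hν : IsCoupling ν D L) {o : Z → O} (ho : Measurable o) {act : Z → A}
    (hact : Measurable act) {o' : W → O'} (ho' : Measurable o') {π : Kernel O A}
    {π' : Kernel O' A'} [IsMarkovKernel π] [IsMarkovKernel π']
    (hπ : D.map o ⊗ₘ π = D.map fun z => (o z, act z)) {K : Kernel (O × O') (A × A')}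
    (hK : ∀ x, IsCoupling (K x) (π x.1) (π' x.2)) :
    ∃ μ, IsCoupling μ D (L ⊗ₘ π'.comap o' ho') ∧
      μ.map (fun y => ((o y.1, y.2.1), (act y.1, y.2.2))) =
        ν.map (Prod.map o id) ⊗ₘ K.comap (Prod.map id o') (measurable_id.prodMap ho') := by
  have := hν.isProbabilityMeasure
  have : IsMarkovKernel K := ⟨fun x => (hK x).isProbabilityMeasure⟩
  let N : Measure ((O × W) × (A × A')) :=
    ν.map (Prod.map o id) ⊗ₘ K.comap (Prod.map id o') (measurable_id.prodMap ho')
  let e := Equiv.prodProdProdComm O W A A'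
  have he : Measurable e := (measurable_fst.fst.prodMk measurable_snd.fst).prodMk
    (measurable_fst.snd.prodMk measurable_snd.snd)
  have he' : Measurable e.symm := (measurable_fst.fst.prodMk measurable_snd.fst).prodMk
    (measurable_fst.snd.prodMk measurable_snd.snd)
  have hoid : Measurable (Prod.map o (id : W → W)) := ho.prodMap measurable_id
  have hobs : IsCoupling (ν.map (Prod.map o id)) (D.map o) L := by
    rw [IsCoupling, Measure.map_map measurable_fst hoid, Measure.map_map measurable_snd hoid,
      ← hν.1, ← hν.2, Measure.map_map ho measurable_fst]
    exact ⟨rfl, rfl⟩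
  have : IsProbabilityMeasure (D.map o) := Measure.isProbabilityMeasure_map ho.aemeasurable
  have := hobs.isProbabilityMeasure
  have hfst : (N.map e).map Prod.fst = D.map fun z => (o z, act z) := by
    rw [Measure.map_map measurable_fst he, ← hπ, ← hobs.1]
    exact map_prodMap_compProd measurable_fst measurable_fst fun x => (hK _).1
  have hsnd : (N.map e).map Prod.snd = L ⊗ₘ π'.comap o' ho' := by
    rw [Measure.map_map measurable_snd he, ← hobs.2]
    exact map_prodMap_compProd measurable_snd measurable_snd fun x => (hK _).2
  obtain ⟨μ, hμ, hμN⟩ := exists_coupling_map_prodMap_eq (ho.prodMk hact) hfst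
  refine ⟨μ, hsnd ▸ hμ, ?_⟩
  calc μ.map (fun y => ((o y.1, y.2.1), (act y.1, y.2.2)))
      = (μ.map (Prod.map (fun z => (o z, act z)) id)).map e.symm :=
        (Measure.map_map he' ((ho.prodMk hact).prodMap measurable_id)).symm
    _ = N := by rw [hμN, Measure.map_map he' he, e.symm_comp_self, Measure.map_id]

theorem couplingProb_compProd_comap_imp_le [StandardBorelSpace W] [StandardBorelSpace A']
    [Nonempty W] [Nonempty A'] {D : Measure Z} [IsProbabilityMeasure D] {L : Measure W}
    {o : Z → O} (ho : Measurable o) {act : Z → A} (hact : Measurable act) {o' : W → O'}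
    (ho' : Measurable o') {π : Kernel O A} {π' : Kernel O' A'} [IsMarkovKernel π]
    [IsMarkovKernel π'] (hπ : D.map o ⊗ₘ π = D.map fun z => (o z, act z))
    {K : Kernel (O × O') (A × A')} (hK : ∀ x, IsCoupling (K x) (π x.1) (π' x.2))
    {G : Set (O × O')} (hG : MeasurableSet G) {S : Set (A × A')} (hS : MeasurableSet S)
    {g : O → ℝ≥0∞} (hg : Measurable g) (hKg : ∀ x ∈ G, K x S ≤ g x.1) :
    couplingProb {y | (o y.1, o' y.2.1) ∈ G → (act y.1, y.2.2) ∈ S} D (L ⊗ₘ π'.comap o' ho') ≤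
      couplingProb {z | (o z.1, o' z.2) ∉ G} D L + ∫⁻ x, g x ∂D.map o := by
  suffices h : ∀ ν, IsCoupling ν D L → couplingProb
      {y | (o y.1, o' y.2.1) ∈ G → (act y.1, y.2.2) ∈ S} D (L ⊗ₘ π'.comap o' ho') ≤
        ν {z | (o z.1, o' z.2) ∉ G} + ∫⁻ x, g x ∂D.map o from
    (le_iInf₂ h).trans_eq (by simp only [couplingProb, ENNReal.iInf_add])
  intro ν hν
  have := hν.isProbabilityMeasure
  have : IsMarkovKernel K := ⟨fun x => (hK x).isProbabilityMeasure⟩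
  obtain ⟨μ, hμ, hμK⟩ := hν.exists_coupling_compProd_comap ho hact ho' hπ hK
  have hoid : Measurable (Prod.map o (id : W → W)) := ho.prodMap measurable_id
  have hidG : MeasurableSet (Prod.map (id : O → O) o' ⁻¹' G) := measurable_id.prodMap ho' hG
  have hglue : Measurable fun y : Z × (W × A') => ((o y.1, y.2.1), (act y.1, y.2.2)) :=
    ((ho.comp measurable_fst).prodMk measurable_snd.fst).prodMk
      ((hact.comp measurable_fst).prodMk measurable_snd.snd)
  have himp : MeasurableSet {y : (O × W) × (A × A') |
      y.1 ∈ Prod.map (id : O → O) o' ⁻¹' G → y.2 ∈ S} :=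
    (measurable_fst hidG).imp (measurable_snd hS)
  calc couplingProb _ D (L ⊗ₘ π'.comap o' ho')
      ≤ μ {y | (o y.1, o' y.2.1) ∈ G → (act y.1, y.2.2) ∈ S} := couplingProb_le hμ _
    _ = (ν.map (Prod.map o id) ⊗ₘ K.comap (Prod.map id o') (measurable_id.prodMap ho'))
          {y | y.1 ∈ Prod.map (id : O → O) o' ⁻¹' G → y.2 ∈ S} := by
        rw [← hμK, Measure.map_apply hglue himp]
        rfl
    _ ≤ ν.map (Prod.map o id) (Prod.map (id : O → O) o' ⁻¹' G)ᶜ +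
          ∫⁻ x, g x.1 ∂ν.map (Prod.map o id) := compProd_imp_le hidG hS fun x hx => hKg _ hx
    _ = ν {z | (o z.1, o' z.2) ∉ G} + ∫⁻ x, g x ∂D.map o := by
        rw [Measure.map_apply hoid hidG.compl, lintegral_map (by fun_prop) hoid,
          ← hν.1, Measure.map_map ho measurable_fst, lintegral_map hg (ho.comp measurable_fst)]
        rfl

theorem couplingProb_map_right_le {S : Set (Z × V)} (hS : MeasurableSet S) {e : W → V}
    (he : Measurable e) (D : Measure Z) (L : Measure W) :
    couplingProb S D (L.map e) ≤ couplingProb (Prod.map id e ⁻¹' S) D L := by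
  have he' : Measurable (Prod.map (id : Z → Z) e) := measurable_id.prodMap he
  refine le_iInf₂ fun ν hν => ?_
  rw [← Measure.map_apply he' hS]
  refine couplingProb_le ⟨?_, ?_⟩ S
  · rw [Measure.map_map measurable_fst he', ← hν.1]
    rfl
  · rw [Measure.map_map measurable_snd he', ← hν.2, Measure.map_map he measurable_snd]
    rfl

theorem couplingProb_compProd_le {S : Set (Z × W)} (hS : MeasurableSet S) {D : Measure Z}
    [IsProbabilityMeasure D] (L : Measure W) (κ : Kernel W A) [IsMarkovKernel κ] :
    couplingProb (Prod.map id Prod.fst ⁻¹' S) D (L ⊗ₘ κ) ≤ couplingProb S D L := by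
  refine le_iInf₂ fun ν hν => ?_
  have := hν.isProbabilityMeasure
  let N : Measure ((Z × W) × A) := ν ⊗ₘ κ.comap Prod.snd measurable_snd
  have hassoc := (MeasurableEquiv.prodAssoc (α := Z) (β := W) (γ := A)).measurable
  have hN : N.map Prod.fst = ν := Measure.fst_compProd _ _
  have hcoupling : IsCoupling (N.map MeasurableEquiv.prodAssoc) D (L ⊗ₘ κ) := by
    constructor
    · rw [Measure.map_map measurable_fst hassoc, ← hν.1]
      conv_rhs => rw [← hN, Measure.map_map measurable_fst measurable_fst]
      rfl
    · rw [Measure.map_map measurable_snd hassoc, ← hν.2]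
      exact map_prodMap_compProd measurable_snd measurable_id fun _ => Measure.map_id
  refine (couplingProb_le hcoupling _).trans_eq ?_
  conv_rhs => rw [← hN, Measure.map_apply measurable_fst hS]
  rw [Measure.map_apply hassoc (measurable_id.prodMap measurable_fst hS)]
  rfl

theorem couplingProb_mono_ae {S T : Set (Z × W)} {D : Measure Z} {L : Measure W}
    (h : ∀ᵐ z ∂D, ∀ w, (z, w) ∈ S → (z, w) ∈ T) : couplingProb S D L ≤ couplingProb T D L :=
  iInf₂_mono fun ν hν => measure_mono_ae <| by
    rw [← hν.1] at h
    filter_upwards [ae_of_ae_map measurable_fst.aemeasurable h] with y hy using hy y.2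

theorem couplingProb_map_self_le {S : Set (Z × W)} (hS : MeasurableSet S) (D : Measure Z)
    {g : Z → W} (hg : Measurable g) : couplingProb S D (D.map g) ≤ D {z | (z, g z) ∈ S} := by
  have hpair : Measurable fun z => (z, g z) := measurable_id.prodMk hg
  refine (couplingProb_le (μ := D.map fun z => (z, g z)) ⟨?_, ?_⟩ S).trans_eq
    (Measure.map_apply hpair hS)
  · rw [Measure.map_map measurable_fst hpair]
    exact Measure.map_id
  · rw [Measure.map_map measurable_snd hpair]
    rfl

end Gluing

section ActionCoupling

variable {Z W O : Type*} [MeasurableSpace Z] [MeasurableSpace W] [MeasurableSpace O]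
  {dx du τ : ℕ} {r r' : ℝ}

theorem exists_coupling_kernel_le_otProb_add_tvDist (P Q : Kernel O (CompAct dx du τ))
    [IsMarkovKernel P] [IsMarkovKernel Q] (hr : r < r' ∨ r = 0 ∧ r' = 0) {η : ℝ≥0∞} (hη : η ≠ 0) :
    ∃ (K : Kernel (O × O) (CompAct dx du τ × CompAct dx du τ)) (g : O → ℝ≥0∞),
      (∀ x, IsCoupling (K x) (P x.1) (Q x.2)) ∧ Measurable g ∧
      (∀ o, g o ≤ otProb r (P o) (Q o) + η) ∧
      ∀ x, K x {z | r' < (dMax z.1 z.2 : ℝ)} ≤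
        g x.1 + ENNReal.ofReal (tvDist (Q x.1) (Q x.2)) := by
  obtain ⟨K₁, hK₁, hle⟩ := exists_coupling_kernel_otProb P Q hr hη
  obtain ⟨K, hK, hK_tv⟩ := exists_coupling_kernel_tvDist
    (K := K₁.comap Prod.fst (measurable_fst (β := O)))
    (P := P.comap Prod.fst measurable_fst) (Q := Q.comap Prod.fst measurable_fst)
    (Q' := Q.comap Prod.snd (measurable_snd (α := O))) fun x => hK₁ x.1
  exact ⟨K, fun o => K₁ o {z | r' < (dMax z.1 z.2 : ℝ)}, hK,
    K₁.measurable_coe (measurableSet_lt_dMax _), hle, fun x => hK_tv x _ (measurableSet_lt_dMax _)⟩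

theorem couplingProb_lt_dMax_le [StandardBorelSpace W] [Nonempty W]
    {P Q : Kernel O (CompAct dx du τ)} [IsMarkovKernel P] [IsMarkovKernel Q] {D : Measure Z}
    [IsProbabilityMeasure D] {L : Measure W} {o : Z → O} (ho : Measurable o)
    {act : Z → CompAct dx du τ} (hact : Measurable act) {o' : W → O} (ho' : Measurable o')
    (hP : D.map o ⊗ₘ P = D.map fun z => (o z, act z)) (hr : r < r' ∨ r = 0 ∧ r' = 0)
    {G : Set (O × O)} (hG : MeasurableSet G) {c : ℝ≥0}
    (hQ : ∀ x ∈ G, tvDist (Q x.1) (Q x.2) ≤ c) :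
    couplingProb {y | (o y.1, o' y.2.1) ∈ G → r' < (dMax (act y.1) y.2.2 : ℝ)} D
        (L ⊗ₘ Q.comap o' ho') ≤
      couplingProb {z | (o z.1, o' z.2) ∉ G} D L +
        (c + ∫⁻ x, otProb r (P x) (Q x) ∂D.map o) := by
  refine ENNReal.le_of_forall_pos_le_add fun η hη _ => ?_
  obtain ⟨K, g, hK, hg, hgle, hKle⟩ :=
    exists_coupling_kernel_le_otProb_add_tvDist P Q hr (ENNReal.coe_ne_zero.2 hη.ne')
  have hKG : ∀ x ∈ G, K x {z | r' < (dMax z.1 z.2 : ℝ)} ≤ g x.1 + c := fun x hx =>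
    (hKle x).trans (by gcongr; exact ENNReal.ofReal_le_of_le_toReal (hQ x hx))
  have : IsProbabilityMeasure (D.map o) := Measure.isProbabilityMeasure_map ho.aemeasurable
  calc couplingProb {y | (o y.1, o' y.2.1) ∈ G → r' < (dMax (act y.1) y.2.2 : ℝ)} D
        (L ⊗ₘ Q.comap o' ho')
      ≤ couplingProb {z | (o z.1, o' z.2) ∉ G} D L + ∫⁻ x, (g x + c) ∂D.map o :=
        couplingProb_compProd_comap_imp_le ho hact ho' hP hK hG (measurableSet_lt_dMax r')
          (hg.add_const _) hKG
    _ ≤ couplingProb {z | (o z.1, o' z.2) ∉ G} D L +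
          ∫⁻ x, (otProb r (P x) (Q x) + (η + c)) ∂D.map o := by
        gcongr _ + ∫⁻ x, ?_ ∂_ with x
        rw [← add_assoc]
        exact add_le_add_left (hgle x) _
    _ = couplingProb {z | (o z.1, o' z.2) ∉ G} D L +
          (c + ∫⁻ x, otProb r (P x) (Q x) ∂D.map o) + η := by
        rw [lintegral_add_right _ measurable_const, lintegral_const, measure_univ, mul_one]
        ring

end ActionCoupling

/-! ### Executing a chunk -/

section Measurability

variable {dx du n τ : ℕ} {f : Vec dx → Vec du → Vec dx}

theorem measurable_applyCtrl :
    Measurable fun z : PrimCtrl dx du × Vec dx => applyCtrl z.1 z.2 := by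
  have h : Continuous fun z : PrimCtrl dx du × Vec dx => applyCtrl z.1 z.2 := by
    unfold applyCtrl
    fun_prop
  have : OpensMeasurableSpace (PrimCtrl dx du × Vec dx) := Prod.opensMeasurableSpace
  exact h.measurable

theorem measurable_rollout (hf : Measurable (Function.uncurry f)) (k : ℕ) :
    Measurable fun z : CompAct dx du τ × Vec dx => rollout f z.1 0 z.2 k := by
  induction k with
  | zero => exact measurable_snd
  | succ k ih =>
    by_cases hk : k < τ
    · simp only [rollout, hk, dite_true, Pi.zero_apply, add_zero]
      exact hf.comp (ih.prodMk (measurable_applyCtrl.comp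
        (((measurable_pi_apply _).comp measurable_fst).prodMk ih)))
    · simpa only [rollout, hk, dite_false] using ih

theorem measurable_execChunk (hf : Measurable (Function.uncurry f)) (h : ℕ) :
    Measurable fun z : Traj dx du n × CompAct dx du τ => execChunk f h z.1 z.2 := by
  have hroll : ∀ k, Measurable fun z : Traj dx du n × CompAct dx du τ =>
      rollout f z.2 0 (stateAt z.1 (h * τ)) k := fun k =>
    (measurable_rollout hf k).comp
      (measurable_snd.prodMk ((measurable_stateAt _).comp measurable_fst))
  unfold execChunk
  refine Measurable.prodMk (measurable_pi_lambda _ fun t => ?_) (measurable_pi_lambda _ fun t => ?_)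
  · split_ifs
    · exact hroll _
    · exact (measurable_pi_apply t).comp measurable_fst.fst
  · split_ifs with hk
    · have ha : Measurable fun z : Traj dx du n × CompAct dx du τ => z.2 ⟨(t : ℕ) - h * τ, hk.2⟩ :=
        (measurable_pi_apply _).comp measurable_snd
      exact measurable_applyCtrl.comp (ha.prodMk (hroll _))
    · exact (measurable_pi_apply t).comp measurable_fst.snd

theorem measurable_initTraj : Measurable (initTraj (dx := dx) (du := du) n) := by
  refine Measurable.prodMk (measurable_pi_lambda _ fun t => ?_) measurable_const
  split_ifs
  exacts [measurable_id, measurable_const]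

end Measurability

section Execution

variable {dx du n H τ h : ℕ} (f : Vec dx → Vec du → Vec dx)

theorem chunk_end_le (hh : h < H) : h * τ + τ ≤ H * τ :=
  (Nat.succ_mul h τ).symm.trans_le (Nat.mul_le_mul_right τ hh)

theorem stateAt_execChunk (hh : h < H) (ρ : Traj dx du (H * τ)) (a : CompAct dx du τ) {k : ℕ}
    (hk : k ≤ τ) :
    stateAt (execChunk f h ρ a) (h * τ + k) = rollout f a 0 (stateAt ρ (h * τ)) k := by
  have := chunk_end_le (τ := τ) hh
  have hlt : h * τ + k < H * τ + 1 := by omega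
  rcases Nat.eq_zero_or_pos k with rfl | hk0
  · simp [stateAt, execChunk, rollout]
  · rw [stateAt, dif_pos hlt, execChunk]
    simp only
    rw [if_pos ⟨by omega, by omega⟩, Nat.add_sub_cancel_left]

theorem inputAt_execChunk (hh : h < H) (ρ : Traj dx du (H * τ)) (a : CompAct dx du τ)
    (k : Fin τ) :
    inputAt (execChunk f h ρ a) (h * τ + k) =
      applyCtrl (a k) (rollout f a 0 (stateAt ρ (h * τ)) k) := by
  have := chunk_end_le (τ := τ) hh
  have hlt : h * τ + k < H * τ := by omega
  rw [inputAt, dif_pos hlt, execChunk]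
  simp only [Nat.add_sub_cancel_left]
  rw [dif_pos ⟨by omega, k.2⟩]

theorem stateAt_execChunk_of_le {t : ℕ} (ht : t ≤ h * τ) (ρ : Traj dx du n)
    (a : CompAct dx du τ) : stateAt (execChunk f h ρ a) t = stateAt ρ t := by
  unfold stateAt
  split_ifs with hlt
  · exact if_neg fun hmem => ht.not_gt hmem.1
  · rfl

theorem inputAt_execChunk_of_lt {t : ℕ} (ht : t < h * τ) (ρ : Traj dx du n)
    (a : CompAct dx du τ) : inputAt (execChunk f h ρ a) t = inputAt ρ t := by
  unfold inputAt
  split_ifs with hlt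
  · exact dif_neg fun hmem => ht.not_ge hmem.1
  · rfl

end Execution

section Replay

variable {dx du H τ : ℕ}

theorem stateAt_chunkIdx (ρ : Traj dx du (H * τ)) (h : Fin H) (k : Fin τ) :
    stateAt ρ (h * τ + k) = ρ.1 (chunkIdx h k).castSucc :=
  dif_pos (chunkIdx h k).castSucc.2

theorem stateAt_chunkIdx_add_one (ρ : Traj dx du (H * τ)) (h : Fin H) (k : Fin τ) :
    stateAt ρ (h * τ + k + 1) = ρ.1 (chunkIdx h k).succ :=
  dif_pos (chunkIdx h k).succ.2

theorem inputAt_chunkIdx (ρ : Traj dx du (H * τ)) (h : Fin H) (k : Fin τ) :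
    inputAt ρ (h * τ + k) = ρ.2 (chunkIdx h k) :=
  dif_pos (chunkIdx h k).2

variable {f : Vec dx → Vec du → Vec dx} {ρ : Traj dx du (H * τ)}
  {κ : Fin (H * τ) → PrimCtrl dx du}
  (hcons : ∀ t, (κ t).1 = ρ.2 t ∧ (κ t).2.1 = ρ.1 t.castSucc)
include hcons

theorem center_chunkAct_of_consistent (h : Fin H) (k : Fin τ) :
    (chunkAct h κ k).2.1 = stateAt ρ (h * τ + k) := by
  rw [stateAt_chunkIdx, chunkAct, (hcons _).2]

theorem applyCtrl_chunkAct_of_consistent (h : Fin H) (k : Fin τ) :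
    applyCtrl (chunkAct h κ k) (stateAt ρ (h * τ + k)) = inputAt ρ (h * τ + k) := by
  rw [applyCtrl, center_chunkAct_of_consistent hcons, sub_self, map_zero, add_zero,
    inputAt_chunkIdx, chunkAct, (hcons _).1]

theorem rollout_chunkAct_of_consistent
    (hdyn : ∀ t : Fin (H * τ), ρ.1 t.succ = f (ρ.1 t.castSucc) (ρ.2 t)) (h : Fin H) {k : ℕ}
    (hk : k ≤ τ) :
    rollout f (chunkAct h κ) 0 (stateAt ρ (h * τ)) k = stateAt ρ (h * τ + k) := by
  induction k with
  | zero => rfl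
  | succ k ih =>
    have happly := applyCtrl_chunkAct_of_consistent hcons h ⟨k, hk⟩
    have hnext := stateAt_chunkIdx_add_one ρ h ⟨k, hk⟩
    rw [rollout, dif_pos (Nat.lt_of_succ_le hk), ih (Nat.le_of_succ_le hk), Pi.zero_apply,
      add_zero, happly, ← add_assoc, hnext, hdyn, ← stateAt_chunkIdx, ← inputAt_chunkIdx]

end Replay

section Closeness

variable {dx du n τ τobs : ℕ} {ε : ℝ≥0} {d : ℝ}

/-- Two observation chunks are `ε`-close, with their current states at distance at most `d`. The
separate tolerance `d` is the one that local stability propagates from chunk to chunk. -/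
def ObsClose (ε : ℝ≥0) (d : ℝ) (o o' : Traj dx du n) : Prop :=
  dTraj o o' ≤ ε ∧ ‖o.1 (Fin.last n) - o'.1 (Fin.last n)‖ ≤ d

/-- Two trajectories are `ε`-close during chunk `h`, with the states that the chunk leads to at
distance at most `d`. -/
def ChunkClose (ε : ℝ≥0) (d : ℝ) (τ h : ℕ) (ρ ρ' : Traj dx du n) : Prop :=
  (∀ k < τ, ‖stateAt ρ (h * τ + k + 1) - stateAt ρ' (h * τ + k + 1)‖ ≤ ε) ∧
  (∀ k < τ, ‖inputAt ρ (h * τ + k) - inputAt ρ' (h * τ + k)‖ ≤ ε) ∧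
  ‖stateAt ρ (h * τ + τ) - stateAt ρ' (h * τ + τ)‖ ≤ d

theorem measurableSet_obsClose (ε : ℝ≥0) (d : ℝ) :
    MeasurableSet {z : Traj dx du n × Traj dx du n | ObsClose ε d z.1 z.2} := by
  have hdist : Continuous fun z : Traj dx du n × Traj dx du n => dTraj z.1 z.2 :=
    (Continuous.finset_sup_apply fun k _ => by fun_prop).max
      (Continuous.finset_sup_apply fun k _ => by fun_prop)
  have hlast : Continuous fun z : Traj dx du n × Traj dx du n =>
      ‖z.1.1 (Fin.last n) - z.2.1 (Fin.last n)‖ := by fun_prop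
  have : OpensMeasurableSpace (Traj dx du n × Traj dx du n) := Prod.opensMeasurableSpace
  exact (measurableSet_le hdist.measurable measurable_const).inter
    (measurableSet_le hlast.measurable measurable_const)

theorem measurableSet_chunkClose (ε : ℝ≥0) (d : ℝ) (τ h : ℕ) :
    MeasurableSet {z : Traj dx du n × Traj dx du n | ChunkClose ε d τ h z.1 z.2} := by
  have hstate : ∀ t, Measurable fun z : Traj dx du n × Traj dx du n =>
      ‖stateAt z.1 t - stateAt z.2 t‖ := fun t =>
    (((measurable_stateAt t).comp measurable_fst).sub
      ((measurable_stateAt t).comp measurable_snd)).norm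
  have hinput : ∀ t, Measurable fun z : Traj dx du n × Traj dx du n =>
      ‖inputAt z.1 t - inputAt z.2 t‖ := fun t =>
    (((measurable_inputAt t).comp measurable_fst).sub
      ((measurable_inputAt t).comp measurable_snd)).norm
  refine MeasurableSet.inter ?_
    (MeasurableSet.inter ?_ (measurableSet_le (hstate _) measurable_const))
  · exact measurableSet_setOfPred.2 <| Measurable.forall fun k => Measurable.forall fun _ =>
      measurableSet_setOfPred.1 (measurableSet_le (hstate _) measurable_const)
  · exact measurableSet_setOfPred.2 <| Measurable.forall fun k => Measurable.forall fun _ =>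
      measurableSet_setOfPred.1 (measurableSet_le (hinput _) measurable_const)

theorem obsChunk_last (hτobs : 1 ≤ τobs) (h : ℕ) (ρ : Traj dx du n) :
    (obsChunk τ τobs h ρ).1 (Fin.last _) = stateAt ρ (h * τ) := by
  simp only [obsChunk, Fin.val_last]
  rw [if_pos (by omega)]
  congr 1
  omega

theorem ChunkClose.obsClose (hτobs : 1 ≤ τobs) (hτ : τobs ≤ τ) {h : ℕ} {ρ ρ' : Traj dx du n}
    (hc : ChunkClose ε d τ h ρ ρ') :
    ObsClose ε d (obsChunk τ τobs (h + 1) ρ) (obsChunk τ τobs (h + 1) ρ') := by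
  have hobserved : ∀ j, τobs ≤ (h + 1) * τ + j + 1 := fun j => by
    rw [Nat.succ_mul]
    omega
  refine ⟨max_le (Finset.sup_le fun j _ => ?_) (Finset.sup_le fun j _ => ?_), ?_⟩
  · have htime : (h + 1) * τ + j + 1 - τobs = h * τ + (τ + j - τobs) + 1 := by
      rw [Nat.succ_mul]
      omega
    simp only [obsChunk]
    rw [if_pos (hobserved _), if_pos (hobserved _), htime, ← NNReal.coe_le_coe, coe_nndist,
      dist_eq_norm]
    exact hc.1 _ (by omega)
  · have htime : (h + 1) * τ + j + 1 - τobs = h * τ + (τ + j + 1 - τobs) := by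
      rw [Nat.succ_mul]
      omega
    simp only [obsChunk]
    rw [if_pos (hobserved _), if_pos (hobserved _), htime, ← NNReal.coe_le_coe, coe_nndist,
      dist_eq_norm]
    exact hc.2.1 _ (by omega)
  · rw [obsChunk_last hτobs, obsChunk_last hτobs, Nat.succ_mul]
    exact hc.2.2

theorem obsChunk_zero_initTraj (hτobs : 1 ≤ τobs) (ρ : Traj dx du n) :
    obsChunk τ τobs 0 (initTraj n (ρ.1 0)) = obsChunk τ τobs 0 ρ := by
  refine Prod.ext (funext fun j => ?_) (funext fun j => ?_)
  · simp only [obsChunk]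
    split_ifs with h
    · have htime : 0 * τ + (j : ℕ) + 1 - τobs = 0 := by omega
      rw [htime]
      simp [stateAt, initTraj]
    · rfl
  · simp only [obsChunk]
    rw [if_neg (by omega), if_neg (by omega)]

theorem obsClose_self (hd : 0 ≤ d) (o : Traj dx du n) : ObsClose ε d o o :=
  ⟨by simp [dTraj], by simpa using hd⟩

theorem ChunkClose.execChunk_iff (f : Vec dx → Vec du → Vec dx) {h m : ℕ} (hm : h < m)
    (ρ ρ' : Traj dx du n) (b : CompAct dx du τ) :
    ChunkClose ε d τ h ρ (execChunk f m ρ' b) ↔ ChunkClose ε d τ h ρ ρ' := by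
  have hend : h * τ + τ ≤ m * τ := chunk_end_le hm
  unfold ChunkClose
  refine and_congr (forall₂_congr fun k hk => ?_) (and_congr (forall₂_congr fun k hk => ?_) ?_)
  · rw [stateAt_execChunk_of_le f (by omega)]
  · rw [inputAt_execChunk_of_lt f (by omega)]
  · rw [stateAt_execChunk_of_le f hend]

theorem chunkClose_execChunk {H : ℕ} (hτobs : 1 ≤ τobs) {f : Vec dx → Vec du → Vec dx}
    {p : StabParams} (hp : p.Positive) (hε1 : ε ≤ 1) (hεr : ε ≤ p.radius) (hτc : p.c3 ≤ τ)
    {ρ : Traj dx du (H * τ)} (hdyn : ∀ t : Fin (H * τ), ρ.1 t.succ = f (ρ.1 t.castSucc) (ρ.2 t))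
    {κ : Fin (H * τ) → PrimCtrl dx du}
    (hcons : ∀ t, (κ t).1 = ρ.2 t ∧ (κ t).2.1 = ρ.1 t.castSucc) {h : Fin H}
    (hstable : IsLocalTISS f p.gain p.decay p.cu p.cξ (chunkAct h κ) (stateAt ρ (h * τ)))
    (hK : ∀ t, ‖(κ t).2.2‖ ≤ p.RK) {ρ' : Traj dx du (H * τ)} {b : CompAct dx du τ}
    (hobs : ObsClose ε (p.stateTol ε) (obsChunk τ τobs h ρ) (obsChunk τ τobs h ρ'))
    (hb : (dMax (chunkAct h κ) b : ℝ) ≤ p.actTol ε) :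
    ChunkClose ε (p.stateTol ε) τ h ρ (execChunk f h ρ' b) := by
  have hreplay := fun k hk => rollout_chunkAct_of_consistent (k := k) hcons hdyn h hk
  have hcenter : ∀ k : Fin τ, (chunkAct h κ k).2.1 =
      rollout f (chunkAct h κ) 0 (stateAt ρ (h * τ)) k := fun k => by
    rw [hreplay k k.2.le, center_chunkAct_of_consistent hcons]
  have hgain : ∀ k, ‖(chunkAct h κ k).2.2‖ ≤ p.RK := fun k => hK _
  have hstart := hobs.2
  rw [obsChunk_last hτobs, obsChunk_last hτobs] at hstart
  have hstates : ∀ k ≤ τ, ‖rollout f (chunkAct h κ) 0 (stateAt ρ (h * τ)) k -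
      rollout f b 0 (stateAt ρ' (h * τ)) k‖ ≤ 3 * p.cγ * p.cβ * p.inputTol ε := fun k hk =>
    norm_rollout_sub_le_inputTol hp ε.2 hε1 hεr hstable hcenter hgain hstart hb hk
  refine ⟨fun k hk => ?_, fun k hk => ?_, ?_⟩
  · rw [add_assoc, stateAt_execChunk f h.2 _ _ hk, ← hreplay _ hk]
    exact (hstates _ hk).trans (hp.mul_inputTol_le ε.2)
  · have happly := applyCtrl_chunkAct_of_consistent hcons h ⟨k, hk⟩
    have hexec := inputAt_execChunk f h.2 ρ' b ⟨k, hk⟩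
    have hgap := norm_inputGap_le (k := ⟨k, hk⟩) hp hε1 hcenter hgain hb
      ((hstates k hk.le).trans (hp.mul_inputTol_le_spread ε.2 hεr))
    dsimp only at happly hexec
    rw [← happly, hexec, ← hreplay k hk.le]
    exact (norm_applyCtrl_rollout_sub_le (hgain _) hgap (hstates k hk.le)).trans
      (hp.RK_mul_add_inputTol_le ε.2)
  · rw [stateAt_execChunk f h.2 _ _ le_rfl, ← hreplay τ le_rfl]
    exact norm_rollout_sub_le_stateTol hp ε.2 hε1 hεr hstable hcenter hgain hstart hb hτc

end Closeness

/-! ### Comparison with the policy -/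

section PolicyCoupling

variable {dx du H τ τobs : ℕ} {f : Vec dx → Vec du → Vec dx} {D : Measure (Traj dx du (H * τ))}
  {synth : Traj dx du (H * τ) → Fin (H * τ) → PrimCtrl dx du}
  {πstar πhat : ChunkPolicy dx du H τ τobs} {ε : ℝ≥0} {d r r' : ℝ}

theorem fst_expertChunkLaw (τobs : ℕ) (D : Measure (Traj dx du (H * τ)))
    (hsynth : Measurable synth) (h : Fin H) :
    (expertChunkLaw τobs D synth h).fst = D.map (obsChunk τ τobs h) := by
  have hact : Measurable fun ρ => chunkAct h (synth ρ) :=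
    measurable_pi_lambda _ fun k => (measurable_pi_apply _).comp hsynth
  rw [Measure.fst, expertChunkLaw,
    Measure.map_map measurable_fst ((measurable_obsChunk τ τobs h).prodMk hact)]
  rfl

theorem couplingProb_not_obsClose_partialLaw_zero (hτobs : 1 ≤ τobs) (hd : 0 ≤ d) :
    couplingProb {z | ¬ObsClose ε d (obsChunk τ τobs 0 z.1) (obsChunk τ τobs 0 z.2)} D
      (partialLaw f (D.map fun ρ => ρ.1 0) πhat 0) = 0 := by
  have hstart : Measurable fun ρ : Traj dx du (H * τ) => ρ.1 0 :=
    (measurable_pi_apply _).comp measurable_fst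
  have hobs := measurable_obsChunk (dx := dx) (du := du) (n := H * τ) τ τobs 0
  have hmeas := ((hobs.comp measurable_fst).prodMk (hobs.comp measurable_snd)
    (measurableSet_obsClose ε d)).compl
  have hself : ∀ ρ : Traj dx du (H * τ),
      ObsClose ε d (obsChunk τ τobs 0 ρ) (obsChunk τ τobs 0 (initTraj (H * τ) (ρ.1 0))) :=
    fun ρ => obsChunk_zero_initTraj hτobs ρ ▸ obsClose_self hd _
  rw [partialLaw, Measure.map_map measurable_initTraj hstart]
  refine nonpos_iff_eq_zero.1
    ((couplingProb_map_self_le hmeas D (measurable_initTraj.comp hstart)).trans_eq ?_)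
  convert measure_empty (μ := D)
  exact Set.eq_empty_iff_forall_notMem.2 fun ρ hρ => hρ (hself ρ)

theorem couplingProb_not_chunkClose_partialLaw_succ_le [IsProbabilityMeasure D]
    (hf : Measurable (Function.uncurry f)) (hsynth : Measurable synth)
    [∀ h, IsMarkovKernel (πstar h)] [∀ h, IsMarkovKernel (πhat h)] {h : Fin H}
    (hπstar : (expertChunkLaw τobs D synth h).IsCondKernel (πstar h))
    {γ : ℝ≥0 → ℝ≥0} (hγ : Monotone γ) (hπhat : IsTVC γ πhat) (hr : r < r' ∨ r = 0 ∧ r' = 0)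
    (hclose : ∀ᵐ ρ ∂D, ∀ ρ' b, ObsClose ε d (obsChunk τ τobs h ρ) (obsChunk τ τobs h ρ') →
      (dMax (chunkAct h (synth ρ)) b : ℝ) ≤ r' → ChunkClose ε d τ h ρ (execChunk f h ρ' b))
    (ν : Measure (Vec dx)) :
    couplingProb {z | ¬ChunkClose ε d τ h z.1 z.2} D (partialLaw f ν πhat (h + 1)) ≤
      couplingProb {z | ¬ObsClose ε d (obsChunk τ τobs h z.1) (obsChunk τ τobs h z.2)} D
        (partialLaw f ν πhat h) +
      (γ ε + ∫⁻ o, otProb r (πstar h o) (πhat h o) ∂(expertChunkLaw τobs D synth h).fst) := by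
  have hobs := measurable_obsChunk (dx := dx) (du := du) (n := H * τ) τ τobs h
  have hact : Measurable fun ρ => chunkAct h (synth ρ) :=
    measurable_pi_lambda _ fun k => (measurable_pi_apply _).comp hsynth
  have hdisint : D.map (obsChunk τ τobs h) ⊗ₘ πstar h =
      D.map fun ρ => (obsChunk τ τobs h ρ, chunkAct h (synth ρ)) := by
    rw [← fst_expertChunkLaw τobs D hsynth h]
    exact hπstar.disintegrate
  let L : Measure (Traj dx du (H * τ)) := partialLaw f ν πhat h
  let G : Set (Traj dx du (τobs - 1) × Traj dx du (τobs - 1)) := {x | ObsClose ε d x.1 x.2}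
  have hTV : ∀ x ∈ G, tvDist (πhat h x.1) (πhat h x.2) ≤ γ ε := fun x hx =>
    (hπhat h x.1 x.2).trans (hγ hx.1)
  rw [partialLaw, dif_pos h.2, fst_expertChunkLaw τobs D hsynth h]
  calc couplingProb {z | ¬ChunkClose ε d τ h z.1 z.2} D
        ((L ⊗ₘ (πhat h).comap (obsChunk τ τobs h) hobs).map fun w => execChunk f h w.1 w.2)
      ≤ couplingProb {y | ¬ChunkClose ε d τ h y.1 (execChunk f h y.2.1 y.2.2)} D
          (L ⊗ₘ (πhat h).comap (obsChunk τ τobs h) hobs) :=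
        couplingProb_map_right_le (measurableSet_chunkClose ε d τ h).compl
          (measurable_execChunk hf h) D _
    _ ≤ couplingProb {y | (obsChunk τ τobs h y.1, obsChunk τ τobs h y.2.1) ∈ G →
          r' < (dMax (chunkAct h (synth y.1)) y.2.2 : ℝ)} D
          (L ⊗ₘ (πhat h).comap (obsChunk τ τobs h) hobs) :=
        couplingProb_mono_ae (hclose.mono fun ρ hρ w hfar hw =>
          not_le.1 fun hle => hfar (hρ w.1 w.2 hw hle))
    _ ≤ couplingProb {z | (obsChunk τ τobs h z.1, obsChunk τ τobs h z.2) ∉ G} D L +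
          (γ ε + ∫⁻ o, otProb r (πstar h o) (πhat h o) ∂D.map (obsChunk τ τobs h)) :=
        couplingProb_lt_dMax_le hobs hact hobs hdisint hr (measurableSet_obsClose ε d) hTV

theorem couplingProb_not_chunkClose_partialLaw_le [IsProbabilityMeasure D]
    (hf : Measurable (Function.uncurry f)) [∀ h, IsMarkovKernel (πhat h)] (ν : Measure (Vec dx))
    {h m : ℕ} (hm : h + 1 ≤ m) :
    couplingProb {z | ¬ChunkClose ε d τ h z.1 z.2} D (partialLaw f ν πhat m) ≤
      couplingProb {z | ¬ChunkClose ε d τ h z.1 z.2} D (partialLaw f ν πhat (h + 1)) := by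
  have hfar := (measurableSet_chunkClose (dx := dx) (du := du) (n := H * τ) ε d τ h).compl
  induction m, hm using Nat.le_induction with
  | base => rfl
  | succ m hm ih =>
    refine le_trans ?_ ih
    rw [partialLaw]
    split_ifs with hmH
    · refine (couplingProb_map_right_le hfar (measurable_execChunk hf m) D _).trans
        (le_trans (couplingProb_mono (fun y hy => ?_) _ _) (couplingProb_compProd_le hfar _ _))
      exact fun hc => hy ((ChunkClose.execChunk_iff f hm _ _ _).2 hc)
    · rfl

theorem ChunkClose.max_norm_sub_le {n : ℕ} (hτ : 0 < τ) {t : Fin n} {ρ ρ' : Traj dx du n}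
    (hc : ChunkClose ε d τ (t / τ) ρ ρ') :
    max ‖ρ.1 t.succ - ρ'.1 t.succ‖ ‖ρ.2 t - ρ'.2 t‖ ≤ ε := by
  have hstate := hc.1 _ (Nat.mod_lt t hτ)
  have hinput := hc.2.1 _ (Nat.mod_lt t hτ)
  rw [Nat.div_add_mod'] at hstate hinput
  simp only [stateAt, inputAt, dif_pos t.2, dif_pos (Nat.succ_lt_succ t.2)] at hstate hinput
  exact max_le hstate hinput

theorem add_le_sum_of_forall_succ_le {b : ℕ → ℝ≥0∞} {c : Fin H → ℝ≥0∞} (hzero : b 0 = 0)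
    (hsucc : ∀ h : Fin H, b (h + 1) ≤ b h + c h) (h : Fin H) : b h + c h ≤ ∑ i, c i := by
  let c' : ℕ → ℝ≥0∞ := fun i => if hi : i < H then c ⟨i, hi⟩ else 0
  have hc' : ∀ i : Fin H, c' i = c i := fun i => dif_pos i.2
  have hb : ∀ m ≤ H, b m ≤ ∑ i ∈ range m, c' i := fun m hm => by
    induction m with
    | zero => exact hzero.le
    | succ m ih =>
      rw [sum_range_succ, hc' ⟨m, hm⟩]
      exact (hsucc ⟨m, hm⟩).trans (add_le_add_left (ih (Nat.le_of_succ_le hm)) _)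
  calc b h + c h ≤ ∑ i ∈ range (h + 1), c' i := by
        rw [sum_range_succ, hc']
        exact add_le_add_left (hb h h.2.le) _
    _ ≤ ∑ i ∈ range H, c' i := sum_le_sum_of_subset (range_subset_range.2 h.2)
    _ = ∑ i, c i := by simp only [sum_range, hc']

theorem margLoss_policyLaw_le [IsProbabilityMeasure D] (hτobs : 1 ≤ τobs) (hτ : τobs ≤ τ)
    (hf : Measurable (Function.uncurry f)) (hsynth : Measurable synth)
    [∀ h, IsMarkovKernel (πstar h)] [∀ h, IsMarkovKernel (πhat h)]
    (hπstar : ∀ h : Fin H, (expertChunkLaw τobs D synth h).IsCondKernel (πstar h))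
    {γ : ℝ≥0 → ℝ≥0} (hγ : Monotone γ) (hπhat : IsTVC γ πhat) (hd : 0 ≤ d)
    (hr : r < r' ∨ r = 0 ∧ r' = 0)
    (hclose : ∀ᵐ ρ ∂D, ∀ (h : Fin H) ρ' b,
      ObsClose ε d (obsChunk τ τobs h ρ) (obsChunk τ τobs h ρ') →
      (dMax (chunkAct h (synth ρ)) b : ℝ) ≤ r' → ChunkClose ε d τ h ρ (execChunk f h ρ' b)) :
    margLoss ε D (policyLaw f D πhat) ≤
      (H : ℝ≥0∞) * (γ ε : ℝ≥0∞) +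
        ∑ h : Fin H, ∫⁻ o, otProb r (πstar h o) (πhat h o)
          ∂(expertChunkLaw τobs D synth h).fst := by
  let L : ℕ → Measure (Traj dx du (H * τ)) := partialLaw f (D.map fun ρ => ρ.1 0) πhat
  let obsGap : ℕ → ℝ≥0∞ := fun m =>
    couplingProb {z | ¬ObsClose ε d (obsChunk τ τobs m z.1) (obsChunk τ τobs m z.2)} D (L m)
  let cost : Fin H → ℝ≥0∞ := fun h => γ ε + ∫⁻ o, otProb r (πstar h o) (πhat h o)
    ∂(expertChunkLaw τobs D synth h).fst
  have hchunk : ∀ h : Fin H, couplingProb {z | ¬ChunkClose ε d τ h z.1 z.2} D (L (h + 1)) ≤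
      obsGap h + cost h := fun h =>
    couplingProb_not_chunkClose_partialLaw_succ_le hf hsynth (hπstar h) hγ hπhat hr
      (hclose.mono fun ρ hρ => hρ h) _
  have hobs : ∀ h : Fin H, obsGap (h + 1) ≤ obsGap h + cost h := fun h =>
    (couplingProb_mono (Set.compl_subset_compl.2 fun _ hz =>
      ChunkClose.obsClose hτobs hτ hz) _ _).trans (hchunk h)
  refine iSup_le fun t => ?_
  have hτ0 : 0 < τ := hτobs.trans hτ
  let h : Fin H := ⟨t / τ, Nat.div_lt_of_lt_mul (t.2.trans_eq (Nat.mul_comm _ _))⟩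
  calc couplingProb {z | (ε : ℝ) < max ‖z.1.1 t.succ - z.2.1 t.succ‖ ‖z.1.2 t - z.2.2 t‖} D (L H)
      ≤ couplingProb {z | ¬ChunkClose ε d τ h z.1 z.2} D (L H) :=
        couplingProb_mono (fun z hz hc => hz.not_ge (hc.max_norm_sub_le hτ0)) _ _
    _ ≤ couplingProb {z | ¬ChunkClose ε d τ h z.1 z.2} D (L (h + 1)) :=
        couplingProb_not_chunkClose_partialLaw_le hf _ h.2
    _ ≤ ∑ h, cost h :=
        (hchunk h).trans (add_le_sum_of_forall_succ_le (b := obsGap)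
          (couplingProb_not_obsClose_partialLaw_zero hτobs hd) hobs h)
    _ = _ := by
        simp only [cost, sum_add_distrib, sum_const, card_univ, Fintype.card_fin, nsmul_eq_mul]

end PolicyCoupling

theorem sum_lintegral_otProb_le {O : Type*} [MeasurableSpace O] {ι : Type*} [Fintype ι]
    {dx du τ : ℕ} {r : ℝ} (hr : 0 < r) (P Q : ι → O → Measure (CompAct dx du τ))
    (μ : ι → Measure O) :
    ∑ i, ∫⁻ o, otProb r (P i o) (Q i o) ∂μ i ≤
      ENNReal.ofReal r⁻¹ * ∑ i, ∫⁻ o, wass1 (P i o) (Q i o) ∂μ i := by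
  rw [mul_sum]
  refine sum_le_sum fun i _ => ?_
  rw [← lintegral_const_mul' _ _ ENNReal.ofReal_ne_top]
  exact lintegral_mono fun o => otProb_le_wass1 hr _ _

namespace StabilityAssumption

variable {dx du H τ : ℕ} {f : Vec dx → Vec du → Vec dx} {D : Measure (Traj dx du (H * τ))}
  [IsProbabilityMeasure D] {synth : Traj dx du (H * τ) → Fin (H * τ) → PrimCtrl dx du}
  {p : StabParams}

theorem positive (hp : StabilityAssumption f D synth p) (hT : 0 < H * τ) : p.Positive where
  cu := hp.cu_pos
  cξ := hp.cξ_pos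
  cγ := hp.cγ_pos
  cβ := hp.cβ_pos
  L := hp.L_pos
  RK := by
    obtain ⟨ρ, hρ⟩ := hp.gains_bounded.exists
    exact (norm_nonneg _).trans (hρ ⟨0, hT⟩)

theorem Rdyn_nonneg (hp : StabilityAssumption f D synth p) : 0 ≤ p.Rdyn := by
  obtain ⟨ρ, hρ⟩ := hp.states_bounded.exists
  exact (norm_nonneg _).trans (hρ 0)

end StabilityAssumption

theorem mainTheorem2_general (dx du H τ τobs : ℕ) (hτobs : 1 ≤ τobs) (hτ : τobs ≤ τ)
    (f : Vec dx → Vec du → Vec dx) (hf : Measurable (Function.uncurry f))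
    (D : Measure (Traj dx du (H * τ))) [IsProbabilityMeasure D]
    (hD : ∀ᵐ ρ ∂D, ∀ t : Fin (H * τ), ρ.1 t.succ = f (ρ.1 t.castSucc) (ρ.2 t))
    (synth : Traj dx du (H * τ) → Fin (H * τ) → PrimCtrl dx du) (hsynth : Measurable synth)
    (p : StabParams) (hp : p.Positive)
    (hcons : ∀ᵐ ρ ∂D, ∀ t : Fin (H * τ),
      (synth ρ t).1 = ρ.2 t ∧ (synth ρ t).2.1 = ρ.1 t.castSucc)
    (hstable : ∀ᵐ ρ ∂D, ∀ h : Fin H,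
      IsLocalTISS f p.gain p.decay p.cu p.cξ (chunkAct h (synth ρ)) (stateAt ρ (h * τ)))
    (hK : ∀ᵐ ρ ∂D, ∀ t, ‖(synth ρ t).2.2‖ ≤ p.RK)
    (πstar : ChunkPolicy dx du H τ τobs) [∀ h, IsMarkovKernel (πstar h)]
    (hπstar : ∀ h : Fin H, (expertChunkLaw τobs D synth h).IsCondKernel (πstar h))
    (πhat : ChunkPolicy dx du H τ τobs) [∀ h, IsMarkovKernel (πhat h)]
    (γ : ℝ≥0 → ℝ≥0) (hγ : Monotone γ) (hπhat : IsTVC γ πhat)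
    (ε : ℝ≥0) (hε1 : ε ≤ 1) (hεr : ε ≤ p.radius) (hτc : p.c3 ≤ (τ : ℝ))
    (c : ℝ) (hc : p.c0 < c) :
    margLoss ε D (policyLaw f D πhat) ≤
        (H : ℝ≥0∞) * (γ ε : ℝ≥0∞) +
          ∑ h : Fin H, ∫⁻ o, otProb ((ε : ℝ) / c) (πstar h o) (πhat h o)
            ∂(expertChunkLaw τobs D synth h).fst ∧
    (0 < ε →
      ∑ h : Fin H, ∫⁻ o, otProb ((ε : ℝ) / c) (πstar h o) (πhat h o)
            ∂(expertChunkLaw τobs D synth h).fst ≤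
        ENNReal.ofReal (c / ε) *
          ∑ h : Fin H, ∫⁻ o, wass1 (πstar h o) (πhat h o)
            ∂(expertChunkLaw τobs D synth h).fst) := by
  have hc0 : 0 < p.c0 := zero_lt_one.trans_le hp.one_le_c0
  have htol : (ε : ℝ) / c < p.actTol ε ∨ (ε : ℝ) / c = 0 ∧ p.actTol ε = 0 := by
    rcases eq_zero_or_pos ε with rfl | hε
    · exact Or.inr ⟨zero_div _, zero_div _⟩
    · exact Or.inl (div_lt_div_of_pos_left (NNReal.coe_pos.2 hε) hc0 hc)
  have hclose : ∀ᵐ ρ ∂D, ∀ (h : Fin H) ρ' b,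
      ObsClose ε (p.stateTol ε) (obsChunk τ τobs h ρ) (obsChunk τ τobs h ρ') →
      (dMax (chunkAct h (synth ρ)) b : ℝ) ≤ p.actTol ε →
      ChunkClose ε (p.stateTol ε) τ h ρ (execChunk f h ρ' b) := by
    filter_upwards [hD, hcons, hstable, hK] with ρ hdyn hcons hstable hK h ρ' b
    exact chunkClose_execChunk hτobs hp hε1 hεr hτc hdyn hcons (hstable h) hK
  refine ⟨margLoss_policyLaw_le hτobs hτ hf hsynth hπstar hγ hπhat (hp.stateTol_nonneg ε.2) htol
    hclose, fun hε => ?_⟩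
  rw [← inv_div (ε : ℝ)]
  exact sum_lintegral_otProb_le (div_pos (NNReal.coe_pos.2 hε) (hc0.trans hc))
    (fun h o => πstar h o) (fun h o => πhat h o) _

theorem mainTheorem2 (dx du H τ τobs : ℕ) (hτobs : 1 ≤ τobs) (hτ : τobs ≤ τ)
    (f : Vec dx → Vec du → Vec dx) (hf : Measurable (Function.uncurry f))
    (D : Measure (Traj dx du (H * τ))) [IsProbabilityMeasure D]
    (hD : ∀ᵐ ρ ∂D, ∀ t : Fin (H * τ), ρ.1 t.succ = f (ρ.1 t.castSucc) (ρ.2 t))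
    (synth : Traj dx du (H * τ) → Fin (H * τ) → PrimCtrl dx du) (hsynth : Measurable synth)
    (p : StabParams) (hp : StabilityAssumption f D synth p)
    (πstar : ChunkPolicy dx du H τ τobs) [∀ h, IsMarkovKernel (πstar h)]
    (hπstar : ∀ h : Fin H, (expertChunkLaw τobs D synth h).IsCondKernel (πstar h))
    (πhat : ChunkPolicy dx du H τ τobs) [∀ h, IsMarkovKernel (πhat h)]
    (γ : ℝ≥0 → ℝ≥0) (hγ : Monotone γ) (hπhat : IsTVC γ πhat)
    (ε : ℝ≥0) (hε : (ε : ℝ) < p.c2) (hτc : p.c3 ≤ (τ : ℝ)) :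
    margLoss ε D (policyLaw f D πhat) ≤
        (H : ℝ≥0∞) * (γ ε : ℝ≥0∞) +
          ∑ h : Fin H, ∫⁻ o, otProb ((ε : ℝ) / p.c1) (πstar h o) (πhat h o)
            ∂(expertChunkLaw τobs D synth h).fst ∧
    (0 < ε →
      ∑ h : Fin H, ∫⁻ o, otProb ((ε : ℝ) / p.c1) (πstar h o) (πhat h o)
            ∂(expertChunkLaw τobs D synth h).fst ≤
        ENNReal.ofReal (p.c1 / ε) *
          ∑ h : Fin H, ∫⁻ o, wass1 (πstar h o) (πhat h o)
            ∂(expertChunkLaw τobs D synth h).fst) := by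
  rcases H.eq_zero_or_pos with rfl | hH
  · exact ⟨iSup_le fun t => absurd t.2 (by simp), by simp⟩
  have hpos : p.Positive := hp.positive (Nat.mul_pos hH (hτobs.trans hτ))
  obtain ⟨hε1, hεr⟩ := hpos.le_of_lt_c2 hε
  exact mainTheorem2_general dx du H τ τobs hτobs hτ f hf D hD synth hsynth p hpos hp.consistent
    hp.stable hp.gains_bounded πstar hπstar πhat γ hγ hπhat ε hε1 hεr hτc p.c1
    (hpos.c0_lt_c1 hp.Rdyn_nonneg)
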